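/- Let $C\subset\mathbb{R}^2$ be a convex body, that is, a bounded convex set with non-empty interior. For an angle $\theta\in\mathbb{T}_{2\pi}=\mathbb{R}/2\pi\mathbb{Z}$ let $\mathbf{u}(\theta)=(\cos\theta,\sin\theta)$, and for $\lambda>0$ put $$K_C(\theta,\lambda)=\Big\{\mathbf{x}\in C:\ \mathbf{x}\cdot\mathbf{u}(\theta)=\inf_{\mathbf{y}\in C}\mathbf{y}\cdot\mathbf{u}(\theta)+\lambda\Big\},\qquad \gamma_C(\theta,\lambda)=\max\{|K_C(\theta,\lambda)|,\,|K_C(\theta+\pi,\lambda)|\},$$ where $|K_C(\theta,\lambda)|$ is the length of the segment $K_C(\theta,\lambda)$. Let $\boldsymbol{\Gamma}_C\colon\mathbb{R}/|\partial C|\mathbb{Z}\to\mathbb{R}^2$ be the arc-length parameterization of the boundary $\partial C$, let $$\nu_C(s)=\Big\{\theta\in\mathbb{T}_{2\pi}:\ \inf_{\mathbf{y}\in C}\mathbf{y}\cdot\mathbf{u}(\theta)=\boldsymbol{\Gamma}_C(s)\cdot\mathbf{u}(\theta)\Big\},$$ and for a set $J\subset\mathbb{T}_{2\pi}$ let $P_C(J)=\big|\{s\in\mathbb{R}/|\partial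 C|\mathbb{Z}:\ \nu_C(s)\cap J\neq\varnothing\}\big|$ (Lebesgue measure). Then for every closed interval $I\subseteq\mathbb{T}_{2\pi}$ of positive length $|I|\le 2\pi$, $$\liminf_{\rho\to+\infty}\ \rho\int_I\gamma_C^2(\theta,\rho^{-1})\,d\theta\ \geq\ P_C(I)+P_C(I+\pi)$$ and $$\limsup_{\rho\to+\infty}\ \rho\int_I\gamma_C^2(\theta,\rho^{-1})\,d\theta\ \leq\ 8P_C(I)+8P_C(I+\pi).$$ -/

import Mathlib

open Filter MeasureTheory

noncomputable section

namespace PlanarBody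

/-- The Euclidean plane. -/
abbrev Plane : Type := EuclideanSpace ℝ (Fin 2)

/-- A convex body: a bounded convex subset of the plane with non-empty interior
(it is not required to be closed). -/
structure IsConvexBody (C : Set Plane) : Prop where
  convex : Convex ℝ C
  isBounded : Bornology.IsBounded C
  nonempty_interior : (interior C).Nonempty

/-- The unit vector `u(θ) = (cos θ, sin θ)`, for an angle `θ` in `ℝ / 2πℤ`. -/
def u (θ : Real.Angle) : Plane := !₂[θ.cos, θ.sin]

/-- The infimum of `y · u(θ)` over `y ∈ C`. It is a minimum when `C` is compact. -/
def supportInf (C : Set Plane) (θ : Real.Angle) : ℝ := ⨅ y : C, inner ℝ (y : Plane) (u θ)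

/-- The chord `K_C(θ, lam)` of `C` in direction `u(θ)` at distance `lam`. -/
def chord (C : Set Plane) (θ : Real.Angle) (lam : ℝ) : Set Plane :=
  {x ∈ C | inner ℝ x (u θ) = supportInf C θ + lam}

/-- The length of the chord. For convex bounded `C` the chord is a (possibly empty, possibly
non-closed) bounded line segment, and its length is its diameter. -/
def chordLength (C : Set Plane) (θ : Real.Angle) (lam : ℝ) : ℝ := Metric.diam (chord C θ lam)

/-- `γ_C(θ, lam) = max {|K_C(θ, lam)|, |K_C(θ + π, lam)|}`. -/
def gam (C : Set Plane) (θ : Real.Angle) (lam : ℝ) : ℝ :=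
  max (chordLength C θ lam) (chordLength C (θ + (Real.pi : Real.Angle)) lam)

/-- A chosen interior point of `C` (arbitrary if the interior is empty). -/
def center (C : Set Plane) : Plane := Classical.epsilon fun x => x ∈ interior C

/-- The closed curve `∂C`, run through counterclockwise by the polar angle around an interior
point `c`: the point of `∂C` on the ray from `c` in direction `u(t)`. As `gauge (C - c)` is the
Minkowski functional of `C` seen from `c`, that point is `c + u(t) / gauge (C - c) (u(t))`. -/
def polarCurve (C : Set Plane) (t : ℝ) : Plane :=
  center C + (gauge ((fun x => x - center C) '' C) (u t))⁻¹ • u t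

/-- The perimeter `|∂C|`: the length (total variation) of one turn of the boundary curve. -/
def perimeter (C : Set Plane) : ℝ :=
  (eVariationOn (polarCurve C) (Set.Icc 0 (2 * Real.pi))).toReal

/-- The arc-length parameterization `Γ_C` of `∂C`, as a function on `ℝ` (of period `|∂C|`): the
boundary curve reparameterized by its length, counted from the polar angle `0`. -/
def arcParam (C : Set Plane) : ℝ → Plane :=
  naturalParameterization (polarCurve C) Set.univ 0

/-- The set of normals `ν_C(s)` at `Γ_C(s)`. -/
def normals (C : Set Plane) (s : ℝ) : Set Real.Angle :=
  {θ | supportInf C θ = inner ℝ (arcParam C s) (u θ)}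

/-- The portion of perimeter `P_C(I)`: the Lebesgue measure of the set of arc-length parameters
`s` modulo `|∂C|`, represented by `0 ≤ s < |∂C|`, for which `ν_C(s)` meets `I`. -/
def portion (C : Set Plane) (I : Set Real.Angle) : ENNReal :=
  volume {s : ℝ | s ∈ Set.Ico 0 (perimeter C) ∧ (normals C s ∩ I).Nonempty}

/-- The closed interval (arc) of angles from `a` to `b`, meant for `a < b ≤ a + 2π`. -/
def arc (a b : ℝ) : Set Real.Angle := (fun t : ℝ => (t : Real.Angle)) '' Set.Icc a b

/-- The set of angles `I + π`. -/
def opposite (I : Set Real.Angle) : Set Real.Angle := (fun θ => θ + (Real.pi : Real.Angle)) '' I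

end PlanarBody

end

/-
Let `h(θ)` be the infimum of `x · u(θ)` over `C`, and let `S(θ)` be the area swept, per unit of
angle, by the chord of direction `θ` at distance `lam` when `θ` turns. The lines of these chords
envelop the curve whose component orthogonal to `u(θ)` is `h'(θ)`, so if the chord spans the
interval `[p, q]` in this component, then `S(θ)` is the integral of `|y - h'(θ)|` over `[p, q]`. It
lies between `(q - p)² / 4` and, as `h'(θ)` is within `O(lam)` of `[p, q]`, `(q - p)² / 2` up to
small errors.

By Fubini, the integral of `S` over `I` is an integral over the boundary points `Γ(s)`, of the
integral of `|∂f/∂θ| cos(θ - θ₀)` over those `θ ∈ I` for which the height `f = Γ(s) · u(θ) - h(θ)`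
of `Γ(s)` is less than `lam`; here `θ₀` is a normal at `Γ(s)`. Since `f` falls to `0` at `θ₀` and
then rises again, this is at most `2 lam`; it is at least `(1 - o(1)) lam` if `θ₀ ∈ I`, and it
vanishes for small `lam` if no normal at `Γ(s)` lies in `I`. Hence the integral of `S / lam` over
`I` lies asymptotically between `P(I)` and `2 P(I)`. Finally, `γ²` is at least each of, and at most
the sum of, the squared lengths of the two opposite chords.
-/

noncomputable section

namespace PlanarBody

open Set
open scoped Real Topology ENNReal NNReal

section Coordinates

/-- The component of `x` along `u(θ)`. -/
def radial (x : Plane) (θ : ℝ) : ℝ := x 0 * Real.cos θ + x 1 * Real.sin θ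

/-- The component of `x` along `u'(θ)`. -/
def tangential (x : Plane) (θ : ℝ) : ℝ := x 1 * Real.cos θ - x 0 * Real.sin θ

variable (x y : Plane) (θ : ℝ)

theorem radial_add : radial (x + y) θ = radial x θ + radial y θ := by
  simp only [radial, PiLp.add_apply]; ring

theorem radial_sub : radial (x - y) θ = radial x θ - radial y θ := by
  simp only [radial, PiLp.sub_apply]; ring

theorem tangential_sub : tangential (x - y) θ = tangential x θ - tangential y θ := by
  simp only [tangential, PiLp.sub_apply]; ring

theorem radial_sq_add_tangential_sq : radial x θ ^ 2 + tangential x θ ^ 2 = ‖x‖ ^ 2 := by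
  rw [EuclideanSpace.norm_sq_eq, Fin.sum_univ_two, Real.norm_eq_abs, Real.norm_eq_abs, sq_abs,
    sq_abs, radial, tangential]
  linear_combination (x 0 ^ 2 + x 1 ^ 2) * Real.sin_sq_add_cos_sq θ

theorem abs_radial_le : |radial x θ| ≤ ‖x‖ :=
  abs_le_of_sq_le_sq (by nlinarith [radial_sq_add_tangential_sq x θ]) (norm_nonneg x)

theorem abs_tangential_le : |tangential x θ| ≤ ‖x‖ :=
  abs_le_of_sq_le_sq (by nlinarith [radial_sq_add_tangential_sq x θ]) (norm_nonneg x)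

theorem radial_add_two_pi : radial x (θ + 2 * π) = radial x θ := by
  simp [radial]

theorem tangential_add_two_pi : tangential x (θ + 2 * π) = tangential x θ := by
  simp [tangential]

theorem radial_add_pi : radial x (θ + π) = -radial x θ := by
  simp only [radial, Real.cos_add_pi, Real.sin_add_pi]; ring

theorem radial_mul_sin (θ₁ θ₂ θ₃ : ℝ) :
    radial x θ₂ * Real.sin (θ₃ - θ₁)
      = radial x θ₁ * Real.sin (θ₃ - θ₂) + radial x θ₃ * Real.sin (θ₂ - θ₁) := by
  simp only [radial, Real.sin_sub]; ring

theorem tangential_eq_rotate (θ₀ : ℝ) :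
    tangential x θ = tangential x θ₀ * Real.cos (θ - θ₀) - radial x θ₀ * Real.sin (θ - θ₀) := by
  simp only [radial, tangential, Real.cos_sub, Real.sin_sub]
  linear_combination (-(x 1 * Real.cos θ - x 0 * Real.sin θ)) * Real.sin_sq_add_cos_sq θ₀

theorem cross_eq_radial_mul_tangential_sub :
    x 0 * y 1 - x 1 * y 0 = radial x θ * tangential y θ - tangential x θ * radial y θ := by
  simp only [radial, tangential]
  linear_combination (-(x 0 * y 1 - x 1 * y 0)) * Real.sin_sq_add_cos_sq θ

theorem hasDerivAt_radial : HasDerivAt (radial x) (tangential x θ) θ :=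
  (((Real.hasDerivAt_cos θ).const_mul (x 0)).add
    ((Real.hasDerivAt_sin θ).const_mul (x 1))).congr_deriv (by rw [tangential]; ring)

theorem continuous_radial : Continuous (radial x) := by
  unfold radial; fun_prop

theorem lipschitzWith_radial : LipschitzWith ‖x‖₊ (radial x) := by
  refine lipschitzWith_of_nnnorm_deriv_le (fun θ => (hasDerivAt_radial x θ).differentiableAt) ?_
  intro θ
  rw [(hasDerivAt_radial x θ).deriv, ← NNReal.coe_le_coe, coe_nnnorm, coe_nnnorm]
  exact abs_tangential_le x θ

theorem exists_radial_comp_neg : ∃ y : Plane, ‖y‖ = ‖x‖ ∧ ∀ θ, radial y θ = radial x (-θ) := by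
  refine ⟨!₂[x 0, -x 1], by simp [EuclideanSpace.norm_eq, Fin.sum_univ_two], fun θ => ?_⟩
  simp [radial]

variable {X : ℝ → Plane} {T : Plane} {s : ℝ}

theorem hasDerivAt_coord (hX : HasDerivAt X T s) (i : Fin 2) :
    HasDerivAt (fun r => X r i) (T i) s :=
  (EuclideanSpace.proj i : Plane →L[ℝ] ℝ).hasFDerivAt.comp_hasDerivAt s hX

theorem hasDerivAt_radial_comp (hX : HasDerivAt X T s) :
    HasDerivAt (fun r => radial (X r) θ) (radial T θ) s :=
  ((hasDerivAt_coord hX 0).mul_const _).add ((hasDerivAt_coord hX 1).mul_const _)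

theorem hasDerivAt_tangential_comp (hX : HasDerivAt X T s) :
    HasDerivAt (fun r => tangential (X r) θ) (tangential T θ) s :=
  ((hasDerivAt_coord hX 1).mul_const _).sub ((hasDerivAt_coord hX 0).mul_const _)

end Coordinates

section Sublevel

variable {f : ℝ → ℝ} {x y z μ : ℝ}

theorem lintegral_enorm_deriv_le_of_monotoneOn (hxz : x ≤ z) (hf : MonotoneOn f (Icc x z)) :
    ∫⁻ t in Icc x z, ‖deriv f t‖ₑ ≤ ENNReal.ofReal (f z - f x) := by
  have hf' : MonotoneOn f (uIcc x z) := by rwa [uIcc_of_le hxz]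
  have integrable : IntegrableOn (deriv f) (Icc x z) :=
    (intervalIntegrable_iff_integrableOn_Icc_of_le hxz).mp hf'.intervalIntegrable_deriv
  have le_increment : ∫ t in Icc x z, deriv f t ≤ f z - f x := by
    have h := hf'.intervalIntegral_deriv_mem_uIcc
    rw [uIcc_of_le (sub_nonneg.mpr (hf ⟨le_rfl, hxz⟩ ⟨hxz, le_rfl⟩ hxz)),
      intervalIntegral.integral_of_le hxz, ← integral_Icc_eq_integral_Ioc] at h
    exact h.2
  have nonneg : ∀ᵐ t ∂volume.restrict (Icc x z), 0 ≤ deriv f t := by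
    rw [← restrict_Ioo_eq_restrict_Icc]
    filter_upwards [ae_restrict_mem measurableSet_Ioo] with t ht
    rw [← derivWithin_of_mem_nhds (Icc_mem_nhds ht.1 ht.2)]
    exact hf.derivWithin_nonneg
  calc ∫⁻ t in Icc x z, ‖deriv f t‖ₑ = ∫⁻ t in Icc x z, ENNReal.ofReal (deriv f t) :=
        lintegral_congr_ae (nonneg.mono fun t ht => Real.enorm_eq_ofReal ht)
    _ = ENNReal.ofReal (∫ t in Icc x z, deriv f t) :=
        (ofReal_integral_eq_lintegral_ofReal integrable nonneg).symm
    _ ≤ ENNReal.ofReal (f z - f x) := ENNReal.ofReal_le_ofReal le_increment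

theorem exists_sublevel_subset_Icc (hf : ContinuousOn f (Icc x z))
    (hne : (Icc x z ∩ {t | f t < μ}).Nonempty) :
    ∃ y ∈ Icc x z, f y ≤ μ ∧ Icc x z ∩ {t | f t < μ} ⊆ Icc x y := by
  have hcompact : IsCompact (Icc x z ∩ f ⁻¹' Iic μ) :=
    isCompact_Icc.of_isClosed_subset (hf.preimage_isClosed_of_isClosed isClosed_Icc isClosed_Iic)
      inter_subset_left
  have hsub : Icc x z ∩ {t | f t < μ} ⊆ Icc x z ∩ f ⁻¹' Iic μ :=
    inter_subset_inter_right _ fun t (ht : f t < μ) => show f t ≤ μ from ht.le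
  obtain ⟨y, hy, hmax⟩ := hcompact.exists_isGreatest (hne.mono hsub)
  exact ⟨y, hy.1, hy.2, fun t ht => ⟨ht.1.1, hmax (hsub ht)⟩⟩

theorem lintegral_enorm_deriv_sublevel_le (hc : ContinuousOn f (Icc x z))
    (hf : MonotoneOn f (Icc x z)) (h0 : 0 ≤ f x) :
    ∫⁻ t in Icc x z ∩ {t | f t < μ}, ‖deriv f t‖ₑ ≤ ENNReal.ofReal μ := by
  rcases (Icc x z ∩ {t | f t < μ}).eq_empty_or_nonempty with hempty | hne
  · simp [hempty]
  obtain ⟨y, hy, hyμ, hsub⟩ := exists_sublevel_subset_Icc hc hne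
  calc ∫⁻ t in Icc x z ∩ {t | f t < μ}, ‖deriv f t‖ₑ
      ≤ ∫⁻ t in Icc x y, ‖deriv f t‖ₑ := lintegral_mono_set hsub
    _ ≤ ENNReal.ofReal (f y - f x) :=
        lintegral_enorm_deriv_le_of_monotoneOn hy.1 (hf.mono (Icc_subset_Icc_right hy.2))
    _ ≤ ENNReal.ofReal μ := ENNReal.ofReal_le_ofReal (by linarith)

theorem exists_uIoc_ae_subset_sublevel (hf : Continuous f) (hz : μ ≤ f z) :
    ∃ y, μ ≤ f y ∧ (uIoc x y : Set ℝ) ≤ᵐ[volume] (uIcc x z ∩ {t | f t < μ} : Set ℝ) := by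
  obtain ⟨y, ⟨hyz, hyμ⟩, hmin⟩ :=
    (isCompact_uIcc.inter_right (isClosed_Ici.preimage hf)).exists_isMinOn
      ⟨z, right_mem_uIcc, hz⟩ (f := fun t => dist t x) (by fun_prop)
  refine ⟨y, hyμ, ?_⟩
  filter_upwards [compl_mem_ae_iff.mpr (measure_singleton y)] with t hty ht
  have htz : t ∈ uIcc x z := uIcc_subset_uIcc_left hyz (uIoc_subset_uIcc ht)
  refine ⟨htz, show f t < μ from ?_⟩
  by_contra! hcon
  have hdist : dist y x ≤ dist t x := hmin ⟨htz, hcon⟩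
  rw [Real.dist_eq, Real.dist_eq] at hdist
  refine hty (?_ : t = y)
  rcases le_total x y with hxy | hxy
  · rw [uIoc_of_le hxy] at ht
    rw [abs_of_nonneg (by linarith), abs_of_nonneg (by linarith [ht.1])] at hdist
    linarith [ht.2]
  · rw [uIoc_of_ge hxy] at ht
    rw [abs_of_nonpos (by linarith), abs_of_nonpos (by linarith [ht.2])] at hdist
    linarith [ht.1]

theorem integrableOn_deriv_of_lipschitz {K : ℝ≥0} (hf : LipschitzWith K f) (s : Set ℝ)
    (hs : volume s ≠ ⊤) : IntegrableOn (deriv f) s :=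
  Measure.integrableOn_of_bounded hs (aestronglyMeasurable_deriv f _)
    (Eventually.of_forall fun _ => norm_deriv_le_of_lipschitz hf)

theorem le_integral_abs_deriv_sublevel {K : ℝ≥0} {a b : ℝ} (hf : LipschitzWith K f)
    (hx : x ∈ Icc a b) (hz : z ∈ Icc a b) (h0 : f x = 0) (hμ : μ ≤ f z) :
    μ ≤ ∫ t in Icc a b ∩ {t | f t < μ}, |deriv f t| := by
  obtain ⟨y, hyμ, hsub⟩ := exists_uIoc_ae_subset_sublevel (x := x) hf.continuous hμ
  have increment : ∫ t in x..y, deriv f t = f y := by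
    rw [(hf.lipschitzOnWith (s := uIcc x y)).absolutelyContinuousOnInterval.integral_deriv_eq_sub,
      h0, sub_zero]
  have hfin : volume (Icc a b ∩ {t | f t < μ}) ≠ ⊤ :=
    (measure_inter_lt_top_of_left_ne_top (by simp)).ne
  calc μ ≤ |∫ t in x..y, deriv f t| := by
        rw [increment]; exact hyμ.trans (le_abs_self _)
    _ ≤ ∫ t in uIoc x y, |deriv f t| := by
        simpa only [Real.norm_eq_abs] using
          intervalIntegral.norm_integral_le_integral_norm_uIoc (f := deriv f) (μ := volume)
    _ ≤ ∫ t in Icc a b ∩ {t | f t < μ}, |deriv f t| :=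
        setIntegral_mono_set (integrableOn_deriv_of_lipschitz hf _ hfin).norm
          (Eventually.of_forall fun _ => abs_nonneg _)
          (hsub.trans (Eventually.of_forall fun t ht => ⟨uIcc_subset_Icc hx hz ht.1, ht.2⟩))

theorem lintegral_enorm_deriv_comp_neg (f : ℝ → ℝ) (s : Set ℝ) :
    ∫⁻ t in Neg.neg ⁻¹' s, ‖deriv (fun t => f (-t)) t‖ₑ = ∫⁻ t in s, ‖deriv f t‖ₑ := by
  rw [← (Measure.measurePreserving_neg volume).setLIntegral_comp_preimage_emb
    (Homeomorph.neg ℝ).measurableEmbedding (fun t => ‖deriv f t‖ₑ) s]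
  simp_rw [deriv_comp_neg, enorm_neg]

theorem lintegral_enorm_deriv_sublevel_le_add_reflection (f : ℝ → ℝ) (θ μ : ℝ) {r : ℝ}
    (hr : 0 ≤ r) :
    ∫⁻ t in Icc (θ - r) (θ + r) ∩ {t | f t < μ}, ‖deriv f t‖ₑ
      ≤ (∫⁻ t in Icc (-θ) (-θ + r) ∩ {t | f (-t) < μ}, ‖deriv (fun t => f (-t)) t‖ₑ)
        + ∫⁻ t in Icc θ (θ + r) ∩ {t | f t < μ}, ‖deriv f t‖ₑ := by
  have hpre : Icc (-θ) (-θ + r) ∩ {t | f (-t) < μ}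
      = Neg.neg ⁻¹' (Icc (θ - r) θ ∩ {t | f t < μ}) := by
    ext t
    simp only [mem_inter_iff, mem_Icc, mem_ofPred_eq, mem_preimage]
    constructor <;> rintro ⟨⟨h₁, h₂⟩, h₃⟩ <;> exact ⟨⟨by linarith, by linarith⟩, h₃⟩
  rw [hpre, lintegral_enorm_deriv_comp_neg]
  refine (lintegral_mono_set ?_).trans (lintegral_union_le _ _ _)
  rw [← union_inter_distrib_right, Icc_union_Icc_eq_Icc (by linarith) (by linarith)]

end Sublevel

section SineRatio

/-- The function `x ↦ k x / sin (x - θ)` is nondecreasing on `[θ, θ + π]`. The denominators are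
cleared, since they vanish at the endpoints. -/
def SineRatioMonotone (k : ℝ → ℝ) (θ : ℝ) : Prop :=
  ∀ ⦃x y⦄, θ ≤ x → x ≤ y → y ≤ θ + π → k x * Real.sin (y - θ) ≤ k y * Real.sin (x - θ)

variable {k : ℝ → ℝ} {θ : ℝ}

theorem SineRatioMonotone.monotoneOn_quadrant (hk : SineRatioMonotone k θ) (hk0 : ∀ x, 0 ≤ k x) :
    MonotoneOn k (Icc θ (θ + π / 2)) := by
  intro x hx y hy hxy
  have hpi := Real.pi_pos
  rcases eq_or_lt_of_le (hx.1.trans hxy) with rfl | hlt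
  · rw [le_antisymm hxy hx.1]
  have sin_pos : 0 < Real.sin (y - θ) :=
    Real.sin_pos_of_pos_of_lt_pi (by linarith) (by linarith [hy.2])
  have sin_le : Real.sin (x - θ) ≤ Real.sin (y - θ) :=
    Real.sin_le_sin_of_le_of_le_pi_div_two (by linarith [hx.1]) (by linarith [hy.2]) (by linarith)
  refine le_of_mul_le_mul_right ?_ sin_pos
  exact (hk hx.1 hxy (by linarith [hy.2])).trans (mul_le_mul_of_nonneg_left sin_le (hk0 y))

theorem SineRatioMonotone.lintegral_quadrant_le (hk : SineRatioMonotone k θ)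
    (hk0 : ∀ x, 0 ≤ k x) (hc : Continuous k) (μ : ℝ) :
    ∫⁻ t in Icc θ (θ + π / 2) ∩ {t | k t < μ}, ‖deriv k t‖ₑ ≤ ENNReal.ofReal μ :=
  lintegral_enorm_deriv_sublevel_le hc.continuousOn (hk.monotoneOn_quadrant hk0) (hk0 θ)

theorem radial_pos_of_mem_Icc {v : Plane} {x z : ℝ} (hθ : 0 < radial v θ) (hz : 0 < radial v z)
    (hzπ : z < θ + π) (hx : x ∈ Icc θ z) : 0 < radial v x := by
  rcases eq_or_lt_of_le hx.1 with rfl | hlt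
  · exact hθ
  have sin_pos : 0 < Real.sin (x - θ) :=
    Real.sin_pos_of_pos_of_lt_pi (by linarith) (by linarith [hx.2])
  have sin_nonneg : 0 ≤ Real.sin (z - x) :=
    Real.sin_nonneg_of_nonneg_of_le_pi (by linarith [hx.2]) (by linarith)
  have sin_nonneg' : 0 ≤ Real.sin (z - θ) :=
    Real.sin_nonneg_of_nonneg_of_le_pi (by linarith [hx.2]) (by linarith)
  refine pos_of_mul_pos_left ?_ sin_nonneg'
  rw [radial_mul_sin v θ x z]
  positivity

theorem SineRatioMonotone.monotoneOn_div_radial (hk : SineRatioMonotone k θ) (hk0 : ∀ x, 0 ≤ k x)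
    {v : Plane} {z : ℝ} (hθ : 0 < radial v θ) (hz : 0 < radial v z) (hzπ : z < θ + π) :
    MonotoneOn (fun x => k x / radial v x) (Icc θ z) := by
  intro x hx y hy hxy
  rcases eq_or_lt_of_le (hx.1.trans hxy) with rfl | hlt
  · rw [le_antisymm hxy hx.1]
  have sin_pos : 0 < Real.sin (y - θ) :=
    Real.sin_pos_of_pos_of_lt_pi (by linarith) (by linarith [hy.2])
  have wx := radial_pos_of_mem_Icc hθ hz hzπ hx
  have wy := radial_pos_of_mem_Icc hθ hz hzπ hy
  have radial_le : radial v y * Real.sin (x - θ) ≤ radial v x * Real.sin (y - θ) := by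
    have : 0 ≤ Real.sin (y - x) :=
      Real.sin_nonneg_of_nonneg_of_le_pi (by linarith) (by linarith [hx.1, hy.2])
    rw [radial_mul_sin v θ x y]
    exact le_add_of_nonneg_left (by positivity)
  refine (div_le_div_iff₀ wx wy).mpr (le_of_mul_le_mul_right ?_ sin_pos)
  calc k x * radial v y * Real.sin (y - θ) = radial v y * (k x * Real.sin (y - θ)) := by ring
    _ ≤ radial v y * (k y * Real.sin (x - θ)) :=
        mul_le_mul_of_nonneg_left (hk hx.1 hxy (hy.2.trans hzπ.le)) wy.le
    _ = k y * (radial v y * Real.sin (x - θ)) := by ring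
    _ ≤ k y * (radial v x * Real.sin (y - θ)) := mul_le_mul_of_nonneg_left radial_le (hk0 y)
    _ = k y * radial v x * Real.sin (y - θ) := by ring

theorem enorm_deriv_le_of_div {w : ℝ → ℝ} {t w' M q : ℝ} (hk : DifferentiableAt ℝ k t)
    (hw : HasDerivAt w w' t) (hwt : w t ≠ 0) (hM : |w t| ≤ M) (hM' : |w'| ≤ M)
    (hq : |k t / w t| ≤ q) :
    ‖deriv k t‖ₑ
      ≤ ENNReal.ofReal M * ‖deriv (fun x => k x / w x) t‖ₑ + ENNReal.ofReal (q * M) := by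
  have hM0 : 0 ≤ M := (abs_nonneg _).trans hM
  have hq0 : 0 ≤ q := (abs_nonneg _).trans hq
  have product_rule : deriv k t = w t * deriv (fun x => k x / w x) t + k t / w t * w' := by
    rw [(hk.hasDerivAt.fun_div hw hwt).deriv]
    field_simp
    ring
  rw [← ofReal_norm, ← ofReal_norm, ← ENNReal.ofReal_mul hM0,
    ← ENNReal.ofReal_add (by positivity) (by positivity), Real.norm_eq_abs, Real.norm_eq_abs,
    product_rule]
  refine ENNReal.ofReal_le_ofReal ((abs_add_le _ _).trans (add_le_add ?_ ?_))
  · rw [abs_mul]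
    exact mul_le_mul_of_nonneg_right hM (abs_nonneg _)
  · rw [abs_mul]
    exact mul_le_mul hq hM' (abs_nonneg _) hq0

theorem lintegral_enorm_deriv_le_of_div {w w' : ℝ → ℝ} {S : Set ℝ} {M q : ℝ}
    (hS : MeasurableSet S) (hk : ∀ᵐ t, DifferentiableAt ℝ k t) (hw : ∀ t, HasDerivAt w (w' t) t)
    (hM : ∀ t, |w t| ≤ M) (hM' : ∀ t, |w' t| ≤ M)
    (hq : ∀ t ∈ S, w t ≠ 0 ∧ |k t / w t| ≤ q) :
    ∫⁻ t in S, ‖deriv k t‖ₑ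
      ≤ ENNReal.ofReal M * (∫⁻ t in S, ‖deriv (fun x => k x / w x) t‖ₑ)
        + ENNReal.ofReal (q * M) * volume S := by
  rw [← lintegral_const_mul _ (measurable_deriv _).enorm, ← setLIntegral_const,
    ← lintegral_add_right _ measurable_const]
  refine lintegral_mono_ae ?_
  filter_upwards [ae_restrict_of_ae hk, ae_restrict_mem hS] with t hd ht
  exact enorm_deriv_le_of_div hd (hw t) (hq t ht).1 (hM t) (hM' t) (hq t ht).2

/-- Beyond the first quadrant `k` need not be monotone, but its quotient by the sinusoid
`radial v` still is, as long as the sinusoid is positive, and it is positive where `k` is small. -/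
theorem SineRatioMonotone.lintegral_deriv_div_radial_le (hk : SineRatioMonotone k θ)
    (hk0 : ∀ x, 0 ≤ k x) (hcont : Continuous k) (h0 : k θ = 0) {v : Plane} {δ μ : ℝ}
    (hδ : 0 < δ) (hw : ∀ φ, δ ≤ k φ + radial v φ) (hμ : μ ≤ δ / 2)
    (hne : (Icc θ (θ + π) ∩ {t | k t < μ}).Nonempty) :
    (∀ t ∈ Icc θ (θ + π) ∩ {t | k t < μ}, 0 < radial v t ∧ k t / radial v t ≤ 2 * μ / δ) ∧
      ∫⁻ t in Icc θ (θ + π) ∩ {t | k t < μ}, ‖deriv (fun x => k x / radial v x) t‖ₑ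
        ≤ ENNReal.ofReal (2 * μ / δ) := by
  obtain ⟨z, hz, hkz, hsub⟩ := exists_sublevel_subset_Icc hcont.continuousOn hne
  have radial_pos : 0 < radial v θ := by linarith [hw θ]
  have radial_pos_z : 0 < radial v z := by linarith [hw z]
  have hzπ : z < θ + π := hz.2.lt_of_ne fun h => by
    rw [h, radial_add_pi] at radial_pos_z; linarith
  have pos : ∀ t ∈ Icc θ z, 0 < radial v t := fun t =>
    radial_pos_of_mem_Icc radial_pos radial_pos_z hzπ
  have ratio_lt : ∀ t ∈ Icc θ (θ + π) ∩ {t | k t < μ}, k t / radial v t < 2 * μ / δ := by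
    intro t ht
    have hkt : k t < μ := ht.2
    rw [div_lt_div_iff₀ (pos t (hsub ht)) hδ]
    nlinarith [hw t, hk0 t]
  refine ⟨fun t ht => ⟨pos t (hsub ht), (ratio_lt t ht).le⟩, ?_⟩
  exact (lintegral_mono_set (subset_inter hsub ratio_lt)).trans
    (lintegral_enorm_deriv_sublevel_le
      (hcont.continuousOn.div (continuous_radial v).continuousOn fun x hx => (pos x hx).ne')
      (hk.monotoneOn_div_radial hk0 radial_pos radial_pos_z hzπ)
      (div_nonneg (hk0 θ) radial_pos.le))

theorem SineRatioMonotone.lintegral_half_turn_le {K : ℝ≥0} (hk : SineRatioMonotone k θ)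
    (hk0 : ∀ x, 0 ≤ k x) (hK : LipschitzWith K k) (h0 : k θ = 0) {v : Plane} {δ M μ : ℝ}
    (hδ : 0 < δ) (hv : ‖v‖ ≤ M) (hw : ∀ φ, δ ≤ k φ + radial v φ) (hμ : μ ≤ δ / 2) :
    ∫⁻ t in Icc θ (θ + π) ∩ {t | k t < μ}, ‖deriv k t‖ₑ
      ≤ ENNReal.ofReal (2 * M / δ * (1 + π) * μ) := by
  have hM : 0 ≤ M := (norm_nonneg v).trans hv
  rcases (Icc θ (θ + π) ∩ {t | k t < μ}).eq_empty_or_nonempty with hempty | hne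
  · simp [hempty]
  have hμ0 : 0 < μ := let ⟨t, ht⟩ := hne; (hk0 t).trans_lt ht.2
  obtain ⟨ratio_le, ratio_integral⟩ :=
    hk.lintegral_deriv_div_radial_le hk0 hK.continuous h0 hδ hw hμ hne
  set S := Icc θ (θ + π) ∩ {t | k t < μ}
  have hSm : MeasurableSet S := measurableSet_Icc.inter
    (measurableSet_lt hK.continuous.measurable measurable_const)
  calc ∫⁻ t in S, ‖deriv k t‖ₑ
      ≤ ENNReal.ofReal M * (∫⁻ t in S, ‖deriv (fun x => k x / radial v x) t‖ₑ)
          + ENNReal.ofReal (2 * μ / δ * M) * volume S := by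
        refine lintegral_enorm_deriv_le_of_div hSm hK.ae_differentiableAt_real (hasDerivAt_radial v)
          (fun t => (abs_radial_le v t).trans hv) (fun t => (abs_tangential_le v t).trans hv)
          fun t ht => ⟨(ratio_le t ht).1.ne', ?_⟩
        rw [abs_of_nonneg (div_nonneg (hk0 t) (ratio_le t ht).1.le)]
        exact (ratio_le t ht).2
    _ ≤ ENNReal.ofReal M * ENNReal.ofReal (2 * μ / δ)
          + ENNReal.ofReal (2 * μ / δ * M) * ENNReal.ofReal π := by
        gcongr
        refine (measure_mono inter_subset_left).trans ?_
        rw [Real.volume_Icc, add_sub_cancel_left]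
    _ = ENNReal.ofReal (2 * M / δ * (1 + π) * μ) := by
        rw [← ENNReal.ofReal_mul hM, ← ENNReal.ofReal_mul (by positivity),
          ← ENNReal.ofReal_add (by positivity) (by positivity)]
        congr 1
        ring

end SineRatio

section SupportedCurve

/-- A closed curve `X` of unit speed around `c`, run through counterclockwise, together with the
function `h` giving the lower supporting lines `{x | radial x θ = h θ}` of the convex set it bounds.
The disc of radius `δ` about `c` lies on the inner side of these lines, and `concave` says that `h`
is a support function (up to sign). -/
structure IsSupportedCurve (X : ℝ → Plane) (h : ℝ → ℝ) (c : Plane) (δ M : ℝ) : Prop where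
  pos : 0 < δ
  lipschitz : LipschitzWith 1 X
  speed : ∀ᵐ s, ‖deriv X s‖ = 1
  orient : ∀ᵐ s, 0 ≤ (X s - c) 0 * (deriv X s) 1 - (X s - c) 1 * (deriv X s) 0
  periodic : Function.Periodic h (2 * π)
  lipschitz_support : ∃ K, LipschitzWith K h
  le_radial : ∀ s θ, h θ ≤ radial (X s) θ
  touch : ∀ s, ∃ θ, h θ = radial (X s) θ
  concave : ∀ x y z, x ≤ y → y ≤ z → z ≤ x + π →
    h x * Real.sin (z - y) + h z * Real.sin (y - x) ≤ h y * Real.sin (z - x)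
  deep : ∀ θ, h θ + δ ≤ radial c θ
  bounded : ∀ s, ‖X s - c‖ ≤ M

/-- The height of the point `X s` over the supporting line in direction `θ`. -/
def height (X : ℝ → Plane) (h : ℝ → ℝ) (s θ : ℝ) : ℝ := radial (X s) θ - h θ

/-- The rate, per unit of arc length `s` and of angle `θ`, at which `X` contributes to the area
swept by a turning chord. The envelope of the lines `radial x θ = h θ + lam` has tangential
component `deriv h θ`, whence the first factor; the second one is the speed of `X` along the
chord. -/
def density (X : ℝ → Plane) (h : ℝ → ℝ) (s θ : ℝ) : ℝ :=
  |tangential (X s) θ - deriv h θ| * -tangential (deriv X s) θ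

/-- The parameter `s` is regular if the supporting lines at `X s` are orthogonal to a unit velocity,
that is, if `u(θ₀)` is the velocity turned by a right angle whenever `θ₀` is a normal. -/
def IsRegularParam (X : ℝ → Plane) (h : ℝ → ℝ) (s : ℝ) : Prop :=
  ∀ θ₀, height X h s θ₀ = 0 → ∀ θ, -tangential (deriv X s) θ = Real.cos (θ - θ₀)

/-- The parameters of the points whose height is less than `lam` for some direction in
`[a, b]`. -/
def lowSet (X : ℝ → Plane) (h : ℝ → ℝ) (a b lam : ℝ) : Set ℝ :=
  {s | ∃ θ ∈ Icc a b, height X h s θ < lam}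

/-- The parameters of the points that touch a supporting line with direction in `[a, b]`. -/
def touchSet (X : ℝ → Plane) (h : ℝ → ℝ) (a b : ℝ) : Set ℝ :=
  {s | ∃ θ ∈ Icc a b, height X h s θ = 0}

theorem setLIntegral_Icc_le_of_periodic {f : ℝ → ℝ≥0∞} (hf : Function.Periodic f (2 * π))
    {a b : ℝ} (hb : b ≤ a + 2 * π) (c : ℝ) :
    ∫⁻ t in Icc a b, f t ≤ ∫⁻ t in Icc (c - π) (c + π), f t := by
  have fundamental := isAddFundamentalDomain_Ioc Real.two_pi_pos (μ := volume)
  calc ∫⁻ t in Icc a b, f t ≤ ∫⁻ t in Icc a (a + 2 * π), f t :=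
        lintegral_mono_set (Icc_subset_Icc_right hb)
    _ = ∫⁻ t in Ioc a (a + 2 * π), f t := by rw [restrict_Ioc_eq_restrict_Icc]
    _ = ∫⁻ t in Ioc (c - π) (c - π + 2 * π), f t :=
        (fundamental a).setLIntegral_eq (fundamental (c - π)) f hf.map_vadd_zmultiples
    _ = ∫⁻ t in Icc (c - π) (c + π), f t := by
        rw [restrict_Ioc_eq_restrict_Icc, show c - π + 2 * π = c + π by ring]

theorem eventually_forall_lt_of_isCompact {k : ℝ → ℝ} {A : Set ℝ} (hA : IsCompact A)
    (hk : Continuous k) (hpos : ∀ x ∈ A, 0 < k x) : ∀ᶠ lam in 𝓝[>] 0, ∀ x ∈ A, lam < k x :=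
  eventually_nhdsWithin_of_eventually_nhds <|
    hA.eventually_forall_of_forall_eventually fun x hx =>
      (isOpen_lt continuous_fst (hk.comp continuous_snd)).mem_nhds (hpos x hx)

variable {X : ℝ → Plane} {h : ℝ → ℝ} {c : Plane} {δ M a b lam s θ₀ : ℝ}

namespace IsRegularParam

theorem cos_eq_one (hs : IsRegularParam X h s) {θ₁ : ℝ} (h₀ : height X h s θ₀ = 0)
    (h₁ : height X h s θ₁ = 0) : Real.cos (θ₁ - θ₀) = 1 := by
  rw [← hs θ₀ h₀, hs θ₁ h₁, sub_self, Real.cos_zero]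

theorem exists_height_ne_zero (hs : IsRegularParam X h s) (hab : a < b) :
    ∃ z ∈ Icc a b, height X h s z ≠ 0 := by
  by_contra! hzero
  have hπ := Real.pi_pos
  have hmem : min b (a + π) ∈ Icc a b := ⟨le_min hab.le (by linarith), min_le_left _ _⟩
  have hcos := hs.cos_eq_one (hzero a ⟨le_rfl, hab.le⟩) (hzero _ hmem)
  have hlt : a < min b (a + π) := lt_min hab (by linarith)
  have hle : min b (a + π) ≤ a + π := min_le_right _ _
  linarith [(Real.cos_eq_one_iff_of_lt_of_lt (by linarith) (by linarith)).mp hcos]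

end IsRegularParam

theorem touchSet_subset_lowSet (hlam : 0 < lam) : touchSet X h a b ⊆ lowSet X h a b lam :=
  fun _ ⟨θ, hθ, hzero⟩ => ⟨θ, hθ, hzero.trans_lt hlam⟩

namespace IsSupportedCurve

theorem height_nonneg (H : IsSupportedCurve X h c δ M) (s θ : ℝ) : 0 ≤ height X h s θ :=
  sub_nonneg.mpr (H.le_radial s θ)

theorem exists_height_eq_zero (H : IsSupportedCurve X h c δ M) (s : ℝ) :
    ∃ θ₀, height X h s θ₀ = 0 :=
  (H.touch s).imp fun _ hθ => sub_eq_zero.mpr hθ.symm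

theorem bound_nonneg (H : IsSupportedCurve X h c δ M) : 0 ≤ M :=
  (norm_nonneg _).trans (H.bounded 0)

theorem periodic_height (H : IsSupportedCurve X h c δ M) (s : ℝ) :
    Function.Periodic (height X h s) (2 * π) :=
  fun θ => by rw [height, height, radial_add_two_pi, H.periodic]

theorem periodic_density (H : IsSupportedCurve X h c δ M) (s : ℝ) :
    Function.Periodic (density X h s) (2 * π) := fun θ => by
  have periodic_deriv : deriv h (θ + 2 * π) = deriv h θ := by
    rw [← deriv_comp_add_const]
    exact congrArg (deriv · θ) (funext H.periodic)
  simp only [density, tangential_add_two_pi, periodic_deriv]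

theorem lipschitz_height (H : IsSupportedCurve X h c δ M) (s : ℝ) :
    ∃ K, LipschitzWith K (height X h s) :=
  let ⟨_, hK⟩ := H.lipschitz_support
  ⟨_, (lipschitzWith_radial (X s)).sub hK⟩

theorem continuous_height (H : IsSupportedCurve X h c δ M) :
    Continuous fun p : ℝ × ℝ => height X h p.1 p.2 := by
  obtain ⟨K, hK⟩ := H.lipschitz_support
  have hh := hK.continuous
  have hX := H.lipschitz.continuous
  unfold height radial
  fun_prop

theorem continuous_height_right (H : IsSupportedCurve X h c δ M) (s : ℝ) :
    Continuous (height X h s) :=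
  H.continuous_height.comp (Continuous.prodMk_right s)

theorem deriv_height (H : IsSupportedCurve X h c δ M) (s : ℝ) :
    ∀ᵐ θ, deriv (height X h s) θ = tangential (X s) θ - deriv h θ := by
  obtain ⟨K, hK⟩ := H.lipschitz_support
  filter_upwards [hK.ae_differentiableAt_real] with θ hθ
  exact ((hasDerivAt_radial (X s) θ).sub hθ.hasDerivAt).deriv

theorem ae_isRegularParam (H : IsSupportedCurve X h c δ M) : ∀ᵐ s, IsRegularParam X h s := by
  filter_upwards [H.lipschitz.ae_differentiableAt_real, H.speed, H.orient]
    with s hd speed orient θ₀ h₀ θ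
  have touches : radial (X s) θ₀ = h θ₀ := sub_eq_zero.mp h₀
  have radial_velocity : radial (deriv X s) θ₀ = 0 :=
    IsLocalMin.hasDerivAt_eq_zero (f := fun r => radial (X r) θ₀)
      (Eventually.of_forall fun r => touches.trans_le (H.le_radial r θ₀))
      (hasDerivAt_radial_comp θ₀ hd.hasDerivAt)
  have radial_neg : radial (X s - c) θ₀ < 0 := by
    rw [radial_sub]; linarith [H.deep θ₀, H.pos]
  have tangential_velocity : tangential (deriv X s) θ₀ = -1 := by
    have norm_sq := radial_sq_add_tangential_sq (deriv X s) θ₀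
    rw [cross_eq_radial_mul_tangential_sub _ _ θ₀, radial_velocity] at orient
    rw [radial_velocity, speed] at norm_sq
    have : tangential (deriv X s) θ₀ ≤ 0 := by
      by_contra! hpos
      nlinarith
    nlinarith
  rw [tangential_eq_rotate _ θ θ₀, tangential_velocity, radial_velocity]
  ring

theorem density_eq (H : IsSupportedCurve X h c δ M) (hs : IsRegularParam X h s)
    (h₀ : height X h s θ₀ = 0) :
    ∀ᵐ θ, density X h s θ = |deriv (height X h s) θ| * Real.cos (θ - θ₀) := by
  filter_upwards [H.deriv_height s] with θ hθ
  rw [density, hs θ₀ h₀ θ, hθ]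

theorem sineRatioMonotone_height (H : IsSupportedCurve X h c δ M) (h₀ : height X h s θ₀ = 0) :
    SineRatioMonotone (height X h s) θ₀ := by
  intro x y hx hxy hy
  have touches : radial (X s) θ₀ = h θ₀ := sub_eq_zero.mp h₀
  have sine := radial_mul_sin (X s) θ₀ x y
  rw [touches] at sine
  simp only [height]
  linarith [H.concave θ₀ x y hx hxy hy]

theorem sineRatioMonotone_height_neg (H : IsSupportedCurve X h c δ M)
    (h₀ : height X h s θ₀ = 0) : SineRatioMonotone (fun t => height X h s (-t)) (-θ₀) := by
  intro x y hx hxy hy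
  have touches : radial (X s) θ₀ = h θ₀ := sub_eq_zero.mp h₀
  have sine := radial_mul_sin (X s) (-y) (-x) θ₀
  have concave := H.concave (-y) (-x) θ₀ (by linarith) (by linarith) (by linarith)
  rw [touches] at sine
  simp only [sub_neg_eq_add, add_comm θ₀, add_comm (-x)] at sine concave
  simp only [height, sub_neg_eq_add]
  linarith

theorem lintegral_deriv_height_quadrants_le (H : IsSupportedCurve X h c δ M)
    (h₀ : height X h s θ₀ = 0) (lam : ℝ) :
    ∫⁻ θ in Icc (θ₀ - π / 2) (θ₀ + π / 2) ∩ {θ | height X h s θ < lam},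
        ‖deriv (height X h s) θ‖ₑ ≤ 2 * ENNReal.ofReal lam := by
  have hc := H.continuous_height_right s
  refine (lintegral_enorm_deriv_sublevel_le_add_reflection _ θ₀ lam (by positivity)).trans ?_
  rw [two_mul]
  exact add_le_add
    ((H.sineRatioMonotone_height_neg h₀).lintegral_quadrant_le (fun _ => H.height_nonneg s _)
      (hc.comp continuous_neg) lam)
    ((H.sineRatioMonotone_height h₀).lintegral_quadrant_le (H.height_nonneg s) hc lam)

theorem lintegral_deriv_height_turn_le (H : IsSupportedCurve X h c δ M)
    (h₀ : height X h s θ₀ = 0) (hlam : lam ≤ δ / 2) :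
    ∫⁻ θ in Icc (θ₀ - π) (θ₀ + π) ∩ {θ | height X h s θ < lam}, ‖deriv (height X h s) θ‖ₑ
      ≤ 2 * ENNReal.ofReal (2 * M / δ * (1 + π) * lam) := by
  obtain ⟨K, hK⟩ := H.lipschitz_height s
  have hKneg : LipschitzWith (K * 1) fun t => height X h s (-t) := hK.comp LipschitzWith.id.neg
  have norm_le : ‖c - X s‖ ≤ M := norm_sub_rev c (X s) ▸ H.bounded s
  have deep : ∀ φ, δ ≤ height X h s φ + radial (c - X s) φ := fun φ => by
    rw [radial_sub, height]; linarith [H.deep φ]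
  obtain ⟨w, hw, radial_w⟩ := exists_radial_comp_neg (c - X s)
  refine (lintegral_enorm_deriv_sublevel_le_add_reflection _ θ₀ lam Real.pi_pos.le).trans ?_
  rw [two_mul]
  exact add_le_add
    ((H.sineRatioMonotone_height_neg h₀).lintegral_half_turn_le (fun _ => H.height_nonneg s _)
      hKneg (by rwa [neg_neg]) H.pos (hw.trans_le norm_le)
      (fun φ => (radial_w φ).symm ▸ deep (-φ)) hlam)
    ((H.sineRatioMonotone_height h₀).lintegral_half_turn_le (H.height_nonneg s) hK h₀ H.pos
      norm_le deep hlam)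

theorem isOpen_lowSet (H : IsSupportedCurve X h c δ M) (a b lam : ℝ) :
    IsOpen (lowSet X h a b lam) := by
  have : lowSet X h a b lam = ⋃ θ ∈ Icc a b, {s | height X h s θ < lam} := by
    ext s; simp [lowSet]
  rw [this]
  exact isOpen_biUnion fun θ _ =>
    isOpen_lt (H.continuous_height.comp (Continuous.prodMk_left θ)) continuous_const

theorem isClosed_touchSet (H : IsSupportedCurve X h c δ M) (a b : ℝ) :
    IsClosed (touchSet X h a b) := by
  rw [← isOpen_compl_iff, isOpen_iff_eventually]
  intro s hs
  have key := (isCompact_Icc (a := a) (b := b)).eventually_forall_of_forall_eventually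
    (P := fun r θ => height X h r θ ≠ 0) (x₀ := s) fun θ hθ =>
      (isOpen_ne_fun H.continuous_height continuous_const).mem_nhds fun hzero => hs ⟨θ, hθ, hzero⟩
  filter_upwards [key] with r hr ⟨θ, hθ, hzero⟩ using hr θ hθ hzero

theorem eventually_notMem_lowSet (H : IsSupportedCurve X h c δ M) (hs : s ∉ touchSet X h a b) :
    ∀ᶠ lam in 𝓝[>] 0, s ∉ lowSet X h a b lam := by
  filter_upwards [eventually_forall_lt_of_isCompact (isCompact_Icc (a := a) (b := b))
    (H.continuous_height_right s) fun θ hθ =>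
      (H.height_nonneg s θ).lt_of_ne fun hzero => hs ⟨θ, hθ, hzero.symm⟩] with lam hlam
  rintro ⟨θ, hθ, hlt⟩
  exact lt_asymm hlt (hlam θ hθ)

theorem tendsto_measure_lowSet (H : IsSupportedCurve X h c δ M) (a b L : ℝ) :
    Tendsto (fun lam => volume.restrict (Ico 0 L) (lowSet X h a b lam)) (𝓝[>] 0)
      (𝓝 (volume.restrict (Ico 0 L) (touchSet X h a b))) := by
  refine tendsto_measure_of_tendsto_indicator_of_isFiniteMeasure _ _
    (fun lam => (H.isOpen_lowSet a b lam).measurableSet) fun s => ?_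
  by_cases hs : s ∈ touchSet X h a b
  · filter_upwards [self_mem_nhdsWithin] with lam hlam
    exact iff_of_true (touchSet_subset_lowSet hlam hs) hs
  · filter_upwards [H.eventually_notMem_lowSet hs] with lam hlam
    exact iff_of_false hlam hs

end IsSupportedCurve

end SupportedCurve

section Sweep

/-- The density `density X h`, restricted to the points of height less than `lam`. -/
def capDensity (X : ℝ → Plane) (h : ℝ → ℝ) (lam s θ : ℝ) : ℝ :=
  {θ | height X h s θ < lam}.indicator (density X h s) θ

/-- The signed area, per unit of angle, swept by the chord at distance `lam` as its direction `θ`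
turns, computed over one period of length `L` of the curve. -/
def sweep (X : ℝ → Plane) (h : ℝ → ℝ) (L lam θ : ℝ) : ℝ :=
  ∫ s in Ico 0 L, capDensity X h lam s θ

/-- The contribution, per unit of arc length, of the point `X s` to the area swept by the chord as
its direction turns through `[a, b]`. -/
def pointSweep (X : ℝ → Plane) (h : ℝ → ℝ) (a b lam s : ℝ) : ℝ :=
  ∫ θ in Icc a b, capDensity X h lam s θ

variable {X : ℝ → Plane} {h : ℝ → ℝ} {c : Plane} {δ M a b lam s : ℝ}

theorem ofReal_integral_le_lintegral_ofReal {α : Type*} [MeasurableSpace α] (ν : Measure α)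
    (f : α → ℝ) : ENNReal.ofReal (∫ x, f x ∂ν) ≤ ∫⁻ x, ENNReal.ofReal (f x) ∂ν := by
  by_cases hf : Integrable f ν
  · rw [integral_eq_lintegral_pos_part_sub_lintegral_neg_part hf]
    exact (ENNReal.ofReal_le_ofReal (sub_le_self _ ENNReal.toReal_nonneg)).trans
      ENNReal.ofReal_toReal_le
  · simp [integral_undef hf]

theorem pointSweep_eq_zero (hs : s ∉ lowSet X h a b lam) : pointSweep X h a b lam s = 0 := by
  refine setIntegral_eq_zero_of_forall_eq_zero fun θ hθ => indicator_of_notMem ?_ _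
  exact fun hlt => hs ⟨θ, hθ, hlt⟩

namespace IsSupportedCurve

theorem measurableSet_height_lt (H : IsSupportedCurve X h c δ M) (s lam : ℝ) :
    MeasurableSet {θ | height X h s θ < lam} :=
  (isOpen_lt (H.continuous_height_right s) continuous_const).measurableSet

theorem measurable_density (H : IsSupportedCurve X h c δ M) :
    Measurable fun p : ℝ × ℝ => density X h p.1 p.2 := by
  have hX := H.lipschitz.continuous
  have hh := measurable_deriv h
  have hX' : ∀ i, Measurable fun s => deriv X s i := fun i =>
    (EuclideanSpace.proj i : Plane →L[ℝ] ℝ).continuous.measurable.comp (measurable_deriv X)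
  have tangential_measurable : Measurable fun p : ℝ × ℝ => tangential (X p.1) p.2 := by
    refine Continuous.measurable ?_
    unfold tangential
    fun_prop
  have tangential_deriv_measurable :
      Measurable fun p : ℝ × ℝ => tangential (deriv X p.1) p.2 :=
    (((hX' 1).comp measurable_fst).mul (Real.measurable_cos.comp measurable_snd)).sub
      (((hX' 0).comp measurable_fst).mul (Real.measurable_sin.comp measurable_snd))
  exact (tangential_measurable.sub (hh.comp measurable_snd)).norm.mul
    tangential_deriv_measurable.neg

theorem exists_abs_density_le (H : IsSupportedCurve X h c δ M) :
    ∃ B, ∀ s θ, |density X h s θ| ≤ B := by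
  obtain ⟨K, hK⟩ := H.lipschitz_support
  refine ⟨(M + ‖c‖) + K, fun s θ => ?_⟩
  have norm_le : ‖X s‖ ≤ M + ‖c‖ := by
    linarith [norm_le_norm_sub_add (X s) c, H.bounded s]
  have velocity_le : |tangential (deriv X s) θ| ≤ 1 :=
    (abs_tangential_le _ _).trans (by simpa using norm_deriv_le_of_lipschitz H.lipschitz (x₀ := s))
  rw [density, abs_mul, abs_abs, abs_neg]
  refine (mul_le_of_le_one_right (abs_nonneg _) velocity_le).trans ((abs_sub _ _).trans ?_)
  exact add_le_add ((abs_tangential_le _ _).trans norm_le) (norm_deriv_le_of_lipschitz hK)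

theorem measurable_capDensity (H : IsSupportedCurve X h c δ M) (lam : ℝ) :
    Measurable (Function.uncurry (capDensity X h lam)) :=
  H.measurable_density.indicator (isOpen_lt H.continuous_height continuous_const).measurableSet

theorem exists_norm_capDensity_le (H : IsSupportedCurve X h c δ M) (lam : ℝ) :
    ∃ B, ∀ s θ, ‖capDensity X h lam s θ‖ ≤ B :=
  H.exists_abs_density_le.imp fun _ hB s θ => (norm_indicator_le_norm_self _ _).trans (hB s θ)

theorem integrable_capDensity (H : IsSupportedCurve X h c δ M) (a b L lam : ℝ) :
    Integrable (Function.uncurry (capDensity X h lam))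
      ((volume.restrict (Ico 0 L)).prod (volume.restrict (Icc a b))) :=
  let ⟨B, hB⟩ := H.exists_norm_capDensity_le lam
  .of_bound (H.measurable_capDensity lam).aestronglyMeasurable B
    (Eventually.of_forall fun p => hB p.1 p.2)

theorem integrableOn_capDensity (H : IsSupportedCurve X h c δ M) (a b lam s : ℝ) :
    IntegrableOn (capDensity X h lam s) (Icc a b) :=
  let ⟨B, hB⟩ := H.exists_norm_capDensity_le lam
  .of_bound (by simp) (H.measurable_capDensity lam).of_uncurry_left.aestronglyMeasurable B
    (Eventually.of_forall (hB s))

theorem integral_sweep (H : IsSupportedCurve X h c δ M) (a b L lam : ℝ) :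
    ∫ θ in Icc a b, sweep X h L lam θ = ∫ s in Ico 0 L, pointSweep X h a b lam s :=
  (integral_integral_swap (H.integrable_capDensity a b L lam)).symm

theorem integrableOn_sweep (H : IsSupportedCurve X h c δ M) (a b L lam : ℝ) :
    IntegrableOn (sweep X h L lam) (Icc a b) :=
  (H.integrable_capDensity a b L lam).integral_prod_right

theorem integrableOn_pointSweep (H : IsSupportedCurve X h c δ M) (a b L lam : ℝ) :
    IntegrableOn (pointSweep X h a b lam) (Ico 0 L) :=
  (H.integrable_capDensity a b L lam).integral_prod_left

theorem periodic_capDensity (H : IsSupportedCurve X h c δ M) (lam s : ℝ) :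
    Function.Periodic (capDensity X h lam s) (2 * π) := fun θ => by
  simp only [capDensity, indicator, mem_ofPred_eq, H.periodic_height s θ, H.periodic_density s θ]

/-- Where the normal makes an obtuse angle with `u(θ)` the density is negative, so only two
quadrants contribute to the positive part. -/
theorem ofReal_capDensity_le (H : IsSupportedCurve X h c δ M) (hs : IsRegularParam X h s)
    {θ₀ : ℝ} (h₀ : height X h s θ₀ = 0) :
    ∀ᵐ θ ∂volume.restrict (Icc (θ₀ - π) (θ₀ + π)), ENNReal.ofReal (capDensity X h lam s θ)
      ≤ (Icc (θ₀ - π / 2) (θ₀ + π / 2) ∩ {θ | height X h s θ < lam}).indicator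
          (fun θ => ‖deriv (height X h s) θ‖ₑ) θ := by
  filter_upwards [ae_restrict_of_ae (H.density_eq hs h₀), ae_restrict_mem measurableSet_Icc]
    with θ hθ hturn
  by_cases hlow : height X h s θ < lam
  swap
  · rw [capDensity, indicator_of_notMem (by exact hlow), ENNReal.ofReal_zero]
    exact zero_le
  rw [capDensity, indicator_of_mem (by exact hlow), hθ]
  by_cases hquad : θ ∈ Icc (θ₀ - π / 2) (θ₀ + π / 2)
  · rw [indicator_of_mem (by exact ⟨hquad, hlow⟩), Real.enorm_eq_ofReal_abs]
    exact ENNReal.ofReal_le_ofReal (mul_le_of_le_one_right (abs_nonneg _) (Real.cos_le_one _))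
  · have cos_nonpos : Real.cos (θ - θ₀) ≤ 0 := by
      rw [← Real.cos_abs]
      refine Real.cos_nonpos_of_pi_div_two_le_of_le ?_ ?_
      · by_contra! hlt
        exact hquad ⟨by linarith [abs_lt.mp hlt], by linarith [abs_lt.mp hlt]⟩
      · have : |θ - θ₀| ≤ π := abs_le.mpr ⟨by linarith [hturn.1], by linarith [hturn.2]⟩
        linarith [Real.pi_pos]
    rw [ENNReal.ofReal_of_nonpos (mul_nonpos_of_nonneg_of_nonpos (abs_nonneg _) cos_nonpos)]
    exact zero_le

theorem pointSweep_le (H : IsSupportedCurve X h c δ M) (hs : IsRegularParam X h s)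
    (hb : b ≤ a + 2 * π) (hlam : 0 < lam) : pointSweep X h a b lam s ≤ 2 * lam := by
  obtain ⟨θ₀, h₀⟩ := H.exists_height_eq_zero s
  have hm := measurableSet_Icc.inter (H.measurableSet_height_lt s lam)
    (s₁ := Icc (θ₀ - π / 2) (θ₀ + π / 2))
  rw [← ENNReal.ofReal_le_ofReal_iff (by positivity)]
  calc ENNReal.ofReal (pointSweep X h a b lam s)
      ≤ ∫⁻ θ in Icc a b, ENNReal.ofReal (capDensity X h lam s θ) :=
        ofReal_integral_le_lintegral_ofReal _ _
    _ ≤ ∫⁻ θ in Icc (θ₀ - π) (θ₀ + π), ENNReal.ofReal (capDensity X h lam s θ) :=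
        setLIntegral_Icc_le_of_periodic ((H.periodic_capDensity lam s).comp ENNReal.ofReal) hb θ₀
    _ ≤ ∫⁻ θ in Icc (θ₀ - π / 2) (θ₀ + π / 2) ∩ {θ | height X h s θ < lam},
          ‖deriv (height X h s) θ‖ₑ := by
        refine (lintegral_mono_ae (H.ofReal_capDensity_le hs h₀)).trans ?_
        rw [setLIntegral_indicator hm]
        exact lintegral_mono_set inter_subset_left
    _ ≤ 2 * ENNReal.ofReal lam := H.lintegral_deriv_height_quadrants_le h₀ lam
    _ = ENNReal.ofReal (2 * lam) := by rw [ENNReal.ofReal_mul zero_le_two, ENNReal.ofReal_ofNat]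

theorem abs_pointSweep_le (H : IsSupportedCurve X h c δ M) (hs : IsRegularParam X h s)
    (hb : b ≤ a + 2 * π) (hlam : 0 < lam) (hlamδ : lam ≤ δ / 2) :
    |pointSweep X h a b lam s| ≤ 2 * (2 * M / δ * (1 + π)) * lam := by
  obtain ⟨θ₀, h₀⟩ := H.exists_height_eq_zero s
  have hM := H.bound_nonneg
  have hδ := H.pos
  have enorm_le : ∀ᵐ θ, ‖capDensity X h lam s θ‖ₑ
      ≤ {θ | height X h s θ < lam}.indicator (fun θ => ‖deriv (height X h s) θ‖ₑ) θ := by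
    filter_upwards [H.density_eq hs h₀] with θ hθ
    rw [capDensity, enorm_indicator_eq_indicator_enorm]
    refine indicator_le_indicator ?_
    rw [hθ, enorm_mul, Real.enorm_abs]
    refine mul_le_of_le_one_right' ?_
    rw [Real.enorm_eq_ofReal_abs, ENNReal.ofReal_le_one]
    exact Real.abs_cos_le_one _
  rw [← ENNReal.ofReal_le_ofReal_iff (by positivity), ← Real.enorm_eq_ofReal_abs]
  calc ‖pointSweep X h a b lam s‖ₑ ≤ ∫⁻ θ in Icc a b, ‖capDensity X h lam s θ‖ₑ :=
        enorm_integral_le_lintegral_enorm _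
    _ ≤ ∫⁻ θ in Icc (θ₀ - π) (θ₀ + π), ‖capDensity X h lam s θ‖ₑ :=
        setLIntegral_Icc_le_of_periodic ((H.periodic_capDensity lam s).comp (‖·‖ₑ)) hb θ₀
    _ ≤ ∫⁻ θ in Icc (θ₀ - π) (θ₀ + π) ∩ {θ | height X h s θ < lam},
          ‖deriv (height X h s) θ‖ₑ := by
        refine (lintegral_mono_ae (ae_restrict_of_ae enorm_le)).trans_eq ?_
        rw [setLIntegral_indicator (H.measurableSet_height_lt s lam), inter_comm]
    _ ≤ 2 * ENNReal.ofReal (2 * M / δ * (1 + π) * lam) := H.lintegral_deriv_height_turn_le h₀ hlamδ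
    _ = ENNReal.ofReal (2 * (2 * M / δ * (1 + π)) * lam) := by
        rw [mul_assoc 2, ENNReal.ofReal_mul zero_le_two, ENNReal.ofReal_ofNat]

/-- For small `lam` the directions counted at a touching point all lie close to the normal, where
the density is almost `|∂height/∂θ|`; this function integrates to at least `lam` on one side. -/
theorem eventually_le_pointSweep (H : IsSupportedCurve X h c δ M) (hs : IsRegularParam X h s)
    (hab : a < b) (hts : s ∈ touchSet X h a b) {ε : ℝ} (hε : 0 < ε) (hε1 : ε ≤ 1) :
    ∀ᶠ lam in 𝓝[>] 0, (1 - ε) * lam ≤ pointSweep X h a b lam s := by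
  obtain ⟨θ₀, hθ₀, h₀⟩ := hts
  obtain ⟨K, hK⟩ := H.lipschitz_height s
  obtain ⟨z, hz, hz0⟩ := hs.exists_height_ne_zero hab
  have far_compact : IsCompact (Icc a b ∩ {θ | Real.cos (θ - θ₀) ≤ 1 - ε}) :=
    isCompact_Icc.inter_right (isClosed_le (by fun_prop) continuous_const)
  have far_pos : ∀ θ ∈ Icc a b ∩ {θ | Real.cos (θ - θ₀) ≤ 1 - ε}, 0 < height X h s θ := by
    rintro θ ⟨_, (hcos : Real.cos (θ - θ₀) ≤ 1 - ε)⟩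
    refine (H.height_nonneg s θ).lt_of_ne fun hzero => ?_
    linarith [hs.cos_eq_one h₀ hzero.symm]
  filter_upwards [eventually_forall_lt_of_isCompact far_compact (H.continuous_height_right s)
    far_pos, Ioo_mem_nhdsGT ((H.height_nonneg s z).lt_of_ne' hz0)] with lam far hlam
  have integrable : IntegrableOn (deriv (height X h s)) (Icc a b) :=
    integrableOn_deriv_of_lipschitz hK _ (by simp)
  have hm := H.measurableSet_height_lt s lam
  calc (1 - ε) * lam
      ≤ (1 - ε) * ∫ θ in Icc a b ∩ {θ | height X h s θ < lam}, |deriv (height X h s) θ| :=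
        mul_le_mul_of_nonneg_left (le_integral_abs_deriv_sublevel hK hθ₀ hz h₀ hlam.2.le)
          (by linarith)
    _ = ∫ θ in Icc a b, {θ | height X h s θ < lam}.indicator
          (fun θ => (1 - ε) * |deriv (height X h s) θ|) θ := by
        rw [setIntegral_indicator hm, integral_const_mul]
    _ ≤ pointSweep X h a b lam s := by
        refine setIntegral_mono_ae_restrict ((integrable.norm.const_mul _).indicator hm)
          (H.integrableOn_capDensity a b lam s) ?_
        filter_upwards [ae_restrict_of_ae (H.density_eq hs h₀), ae_restrict_mem measurableSet_Icc]
          with θ hθ hmem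
        refine indicator_le_indicator' fun hlow => ?_
        have cos_ge : 1 - ε ≤ Real.cos (θ - θ₀) := by
          by_contra! hlt
          exact lt_asymm hlow (far θ ⟨hmem, hlt.le⟩)
        rw [hθ, mul_comm]
        exact mul_le_mul_of_nonneg_left cos_ge (abs_nonneg _)

theorem tendsto_integral_min_pointSweep (H : IsSupportedCurve X h c δ M) (hab : a < b)
    (hb : b ≤ a + 2 * π) (L : ℝ) :
    Tendsto (fun lam => ∫ s in Ico 0 L, min (lam⁻¹ * pointSweep X h a b lam s) 1) (𝓝[>] 0)
      (𝓝 ((volume.restrict (Ico 0 L)).real (touchSet X h a b))) := by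
  rw [← integral_indicator_one (H.isClosed_touchSet a b).measurableSet]
  refine tendsto_integral_filter_of_dominated_convergence
    (fun _ => 2 * (2 * M / δ * (1 + π)) + 1)
    (Eventually.of_forall fun lam =>
      ((H.integrableOn_pointSweep a b L lam).const_mul _).1.inf aestronglyMeasurable_const)
    ?_ (integrable_const _) (ae_restrict_of_ae ?_)
  · filter_upwards [Ioo_mem_nhdsGT (half_pos H.pos)] with lam hlam
    refine ae_restrict_of_ae ?_
    filter_upwards [H.ae_isRegularParam] with s hs
    have bound := H.abs_pointSweep_le hs hb hlam.1 hlam.2.le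
    have scaled_bound : |lam⁻¹ * pointSweep X h a b lam s| ≤ 2 * (2 * M / δ * (1 + π)) := by
      rw [abs_mul, abs_of_pos (inv_pos.mpr hlam.1), inv_mul_le_iff₀ hlam.1, mul_comm lam]
      exact bound
    refine abs_min_le_max_abs_abs.trans (max_le (by linarith) ?_)
    rw [abs_one]
    linarith [abs_nonneg (lam⁻¹ * pointSweep X h a b lam s)]
  · filter_upwards [H.ae_isRegularParam] with s hs
    by_cases hts : s ∈ touchSet X h a b
    · rw [indicator_of_mem hts, Pi.one_apply]
      refine tendsto_order.mpr ⟨fun x hx => ?_, fun x hx =>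
        Eventually.of_forall fun lam => (min_le_right _ _).trans_lt hx⟩
      obtain ⟨y, hxy, hy⟩ := exists_between (max_lt hx one_pos)
      have hy0 : 0 < y := (le_max_right _ _).trans_lt hxy
      filter_upwards [H.eventually_le_pointSweep hs hab hts (sub_pos.mpr hy) (by linarith),
        self_mem_nhdsWithin] with lam hle (hlam : 0 < lam)
      refine lt_min (((le_max_left _ _).trans_lt hxy).trans_le ?_) hx
      rw [sub_sub_cancel] at hle
      rwa [le_inv_mul_iff₀ hlam, mul_comm]
    · rw [indicator_of_notMem hts]
      refine tendsto_const_nhds.congr' ?_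
      filter_upwards [H.eventually_notMem_lowSet hts] with lam hlam
      rw [pointSweep_eq_zero hlam, mul_zero, min_eq_left zero_le_one]

theorem measure_touchSet_le_liminf (H : IsSupportedCurve X h c δ M) (hab : a < b)
    (hb : b ≤ a + 2 * π) (L : ℝ) :
    volume.restrict (Ico 0 L) (touchSet X h a b)
      ≤ liminf (fun lam => ENNReal.ofReal (lam⁻¹ * ∫ θ in Icc a b, sweep X h L lam θ))
          (𝓝[>] 0) := by
  have limit := ENNReal.tendsto_ofReal (H.tendsto_integral_min_pointSweep hab hb L)
  rw [ofReal_measureReal] at limit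
  rw [← limit.liminf_eq]
  refine liminf_le_liminf (Eventually.of_forall fun lam => ENNReal.ofReal_le_ofReal ?_)
  have integrable := (H.integrableOn_pointSweep a b L lam).const_mul lam⁻¹
  rw [H.integral_sweep, ← integral_const_mul]
  exact integral_mono (integrable.inf (integrable_const 1)) integrable fun s => min_le_left _ _

theorem ofReal_integral_sweep_le_measure_lowSet (H : IsSupportedCurve X h c δ M)
    (hb : b ≤ a + 2 * π) (L : ℝ) (hlam : 0 < lam) :
    ENNReal.ofReal (lam⁻¹ * ∫ θ in Icc a b, sweep X h L lam θ)
      ≤ 2 * volume.restrict (Ico 0 L) (lowSet X h a b lam) := by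
  have hlow := (H.isOpen_lowSet a b lam).measurableSet
  have pointwise : ∀ᵐ s, pointSweep X h a b lam s
      ≤ (lowSet X h a b lam).indicator (fun _ => 2 * lam) s := by
    filter_upwards [H.ae_isRegularParam] with s hs
    by_cases hmem : s ∈ lowSet X h a b lam
    · rw [indicator_of_mem hmem]
      exact H.pointSweep_le hs hb hlam
    · rw [indicator_of_notMem hmem, pointSweep_eq_zero hmem]
  rw [H.integral_sweep, ← ofReal_measureReal, ← ENNReal.ofReal_ofNat 2,
    ← ENNReal.ofReal_mul zero_le_two]
  refine ENNReal.ofReal_le_ofReal ((inv_mul_le_iff₀ hlam).mpr ?_)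
  calc ∫ s in Ico 0 L, pointSweep X h a b lam s
      ≤ ∫ s in Ico 0 L, (lowSet X h a b lam).indicator (fun _ => 2 * lam) s :=
        integral_mono_ae (H.integrableOn_pointSweep a b L lam)
          ((integrable_const _).indicator hlow) (ae_restrict_of_ae pointwise)
    _ = lam * (2 * (volume.restrict (Ico 0 L)).real (lowSet X h a b lam)) := by
        rw [integral_indicator_const _ hlow, smul_eq_mul]
        ring

end IsSupportedCurve

end Sweep

section UnitSpeed

variable {E : Type*} [NormedAddCommGroup E] [InnerProductSpace ℝ E] [FiniteDimensional ℝ E]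
  {X : ℝ → E} {K : ℝ≥0} {p q : ℝ}

theorem intervalIntegrable_norm_deriv (hX : LipschitzWith K X) (p q : ℝ) :
    IntervalIntegrable (fun t => ‖deriv X t‖) volume p q := by
  have hconst : IntervalIntegrable (fun _ : ℝ => (K : ℝ)) volume p q := intervalIntegrable_const
  refine hconst.mono_fun (stronglyMeasurable_deriv X).norm.aestronglyMeasurable
    (Eventually.of_forall fun t => ?_)
  simpa using norm_deriv_le_of_lipschitz hX (x₀ := t)

theorem norm_sub_le_integral_norm_deriv (hX : LipschitzWith K X) (hpq : p ≤ q) :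
    ‖X q - X p‖ ≤ ∫ t in p..q, ‖deriv X t‖ := by
  set v := X q - X p with hv
  rcases eq_or_ne v 0 with h0 | h0
  · rw [h0, norm_zero]
    exact intervalIntegral.integral_nonneg hpq fun t _ => norm_nonneg _
  have lipschitz : LipschitzWith (‖innerSL ℝ v‖₊ * K) (fun t => innerSL ℝ v (X t)) :=
    (innerSL ℝ v).lipschitz.comp hX
  have hac := (lipschitz.lipschitzOnWith (s := uIcc p q)).absolutelyContinuousOnInterval
  refine le_of_mul_le_mul_left ?_ (norm_pos_iff.mpr h0)
  calc ‖v‖ * ‖v‖ = innerSL ℝ v (X q) - innerSL ℝ v (X p) := by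
        rw [← map_sub, ← hv, innerSL_apply_apply, real_inner_self_eq_norm_mul_norm]
    _ = ∫ t in p..q, deriv (fun t => innerSL ℝ v (X t)) t := hac.integral_deriv_eq_sub.symm
    _ ≤ ∫ t in p..q, ‖v‖ * ‖deriv X t‖ := by
        refine intervalIntegral.integral_mono_ae hpq hac.intervalIntegrable_deriv
          ((intervalIntegrable_norm_deriv hX p q).const_mul _) ?_
        filter_upwards [hX.ae_differentiableAt_real] with t ht
        have hderiv : HasDerivAt (fun t => innerSL ℝ v (X t)) (innerSL ℝ v (deriv X t)) t :=
          (innerSL ℝ v).hasFDerivAt.comp_hasDerivAt t ht.hasDerivAt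
        rw [hderiv.deriv, innerSL_apply_apply]
        exact real_inner_le_norm _ _
    _ = ‖v‖ * ∫ t in p..q, ‖deriv X t‖ := intervalIntegral.integral_const_mul _ _

theorem eVariationOn_le_of_edist_le {α F G : Type*} [LinearOrder α] [PseudoEMetricSpace F]
    [PseudoEMetricSpace G] {f : α → F} {g : α → G} {s : Set α}
    (h : ∀ x ∈ s, ∀ y ∈ s, x ≤ y → edist (f x) (f y) ≤ edist (g x) (g y)) :
    eVariationOn f s ≤ eVariationOn g s := by
  refine iSup_mono fun p => Finset.sum_le_sum fun i _ => ?_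
  rw [edist_comm, edist_comm (g _)]
  exact h _ (p.2.2.2 _) _ (p.2.2.2 _) (p.2.2.1 i.le_succ)

theorem eVariationOn_Icc_le_integral_norm_deriv (hX : LipschitzWith K X) (hpq : p ≤ q) :
    eVariationOn X (Icc p q) ≤ ENNReal.ofReal (∫ t in p..q, ‖deriv X t‖) := by
  set g : ℝ → ℝ := fun t => ∫ r in p..t, ‖deriv X r‖
  have sub_eq : ∀ x y, g y - g x = ∫ r in x..y, ‖deriv X r‖ := fun x y =>
    intervalIntegral.integral_interval_sub_left (intervalIntegrable_norm_deriv hX _ _)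
      (intervalIntegrable_norm_deriv hX _ _)
  have mono : MonotoneOn g (Icc p q) := fun x _ y _ hxy => by
    rw [← sub_nonneg, sub_eq]
    exact intervalIntegral.integral_nonneg hxy fun t _ => norm_nonneg _
  calc eVariationOn X (Icc p q) ≤ eVariationOn g (Icc p q) := by
        refine eVariationOn_le_of_edist_le fun x _ y _ hxy => ?_
        rw [edist_dist, edist_dist, dist_comm, dist_eq_norm, dist_comm, Real.dist_eq, sub_eq]
        exact ENNReal.ofReal_le_ofReal
          ((norm_sub_le_integral_norm_deriv hX hxy).trans (le_abs_self _))
    _ = ENNReal.ofReal (∫ t in p..q, ‖deriv X t‖) := by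
        rw [← sub_eq, ← mono.eVariationOn_eq (left_mem_Icc.mpr hpq) (right_mem_Icc.mpr hpq),
          inter_self]

theorem eVariationOn_Icc_of_hasUnitSpeedOn {F : Type*} [PseudoEMetricSpace F] {Y : ℝ → F}
    (hu : HasUnitSpeedOn Y univ) (p q : ℝ) :
    eVariationOn Y (Icc p q) = ENNReal.ofReal (q - p) := by
  simpa using hu (mem_univ p) (mem_univ q)

theorem lipschitzWith_of_hasUnitSpeedOn {F : Type*} [PseudoEMetricSpace F] {Y : ℝ → F}
    (hu : HasUnitSpeedOn Y univ) : LipschitzWith 1 Y := by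
  have key : ∀ s t, s ≤ t → edist (Y s) (Y t) ≤ edist s t := fun s t hst => by
    rw [edist_comm s, edist_dist, Real.dist_eq, abs_of_nonneg (sub_nonneg.mpr hst),
      ← eVariationOn_Icc_of_hasUnitSpeedOn hu]
    exact eVariationOn.edist_le Y (left_mem_Icc.mpr hst) (right_mem_Icc.mpr hst)
  intro s t
  rw [ENNReal.coe_one, one_mul]
  rcases le_total s t with h | h
  · exact key s t h
  · rw [edist_comm, edist_comm s]
    exact key t s h

/- The defect `1 - ‖X'‖` is nonnegative, and its integral over an interval is at most zero because
the length of the curve does not exceed the integral of its speed. -/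
theorem ae_Ioc_norm_deriv_eq_one (hu : HasUnitSpeedOn X univ) (hpq : p ≤ q) :
    ∀ᵐ s, s ∈ Ioc p q → ‖deriv X s‖ = 1 := by
  have lipschitz := lipschitzWith_of_hasUnitSpeedOn hu
  have integrable := intervalIntegrable_norm_deriv lipschitz p q
  have defect_nonneg : ∀ t, 0 ≤ 1 - ‖deriv X t‖ := fun t =>
    sub_nonneg.mpr (by simpa using norm_deriv_le_of_lipschitz lipschitz (x₀ := t))
  have length_le : q - p ≤ ∫ t in p..q, ‖deriv X t‖ := by
    refine (ENNReal.ofReal_le_ofReal_iff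
      (intervalIntegral.integral_nonneg hpq fun t _ => norm_nonneg _)).mp ?_
    rw [← eVariationOn_Icc_of_hasUnitSpeedOn hu]
    exact eVariationOn_Icc_le_integral_norm_deriv lipschitz hpq
  have integral_defect : ∫ t in p..q, (1 - ‖deriv X t‖) = 0 := by
    refine le_antisymm ?_ (intervalIntegral.integral_nonneg hpq fun t _ => defect_nonneg t)
    rw [intervalIntegral.integral_sub intervalIntegrable_const integrable,
      intervalIntegral.integral_const, smul_eq_mul]
    linarith
  rw [intervalIntegral.integral_eq_zero_iff_of_le_of_nonneg_ae hpq
    (Eventually.of_forall defect_nonneg) (intervalIntegrable_const.sub integrable),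
    EventuallyEq, ae_restrict_iff' measurableSet_Ioc] at integral_defect
  filter_upwards [integral_defect] with t ht hmem
  exact (sub_eq_zero.mp (ht hmem)).symm

theorem ae_norm_deriv_eq_one (hu : HasUnitSpeedOn X univ) : ∀ᵐ s, ‖deriv X s‖ = 1 := by
  have exhaust : ∀ᵐ s, ∀ n : ℕ, s ∈ Ioc (-(n : ℝ)) n → ‖deriv X s‖ = 1 :=
    ae_all_iff.mpr fun n => ae_Ioc_norm_deriv_eq_one hu (neg_le_self n.cast_nonneg)
  filter_upwards [exhaust] with s hs
  obtain ⟨n, hn⟩ := exists_nat_gt |s|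
  exact hs n ⟨(abs_lt.mp hn).1, (abs_lt.mp hn).2.le⟩

end UnitSpeed

section Parameterization

/-- The signed length of the curve `γ` from the parameter `0`. -/
def arcLength {E : Type*} [PseudoEMetricSpace E] (γ : ℝ → E) : ℝ → ℝ :=
  variationOnFromTo γ univ 0

variable {E : Type*} [MetricSpace E] {γ : ℝ → E} {K : ℝ≥0} {T : ℝ}

theorem arcLength_of_nonneg (γ : ℝ → E) {t : ℝ} (ht : 0 ≤ t) :
    arcLength γ t = (eVariationOn γ (Icc 0 t)).toReal := by
  rw [arcLength, variationOnFromTo.eq_of_le _ _ ht, univ_inter]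

theorem monotone_arcLength (hγ : LipschitzWith K γ) : Monotone (arcLength γ) :=
  monotoneOn_univ.mp
    (variationOnFromTo.monotoneOn (hγ.locallyBoundedVariationOn univ) (mem_univ 0))

theorem eVariationOn_Icc_le_of_lipschitz (hγ : LipschitzWith K γ) (s t : ℝ) :
    eVariationOn γ (Icc s t) ≤ K * ENNReal.ofReal (t - s) := by
  simpa using (hγ.lipschitzOnWith (s := univ)).comp_eVariationOn_le (g := id)
    (mapsTo_univ _ (Icc s t))

theorem continuous_arcLength (hγ : LipschitzWith K γ) : Continuous (arcLength γ) := by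
  refine (LipschitzWith.of_le_add_mul K fun s t => ?_).continuous
  rcases le_total s t with h | h
  · exact (monotone_arcLength hγ h).trans (le_add_of_nonneg_right (by positivity))
  · have length_le := ENNReal.toReal_mono (by finiteness) (eVariationOn_Icc_le_of_lipschitz hγ t s)
    rw [ENNReal.toReal_mul, ENNReal.toReal_ofReal (sub_nonneg.mpr h), ENNReal.coe_toReal]
      at length_le
    rwa [Real.dist_eq, abs_of_nonneg (sub_nonneg.mpr h), ← sub_le_iff_le_add', arcLength,
      variationOnFromTo.sub_right (hγ.locallyBoundedVariationOn _) (mem_univ _) (mem_univ _)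
      (mem_univ _), variationOnFromTo.eq_of_le _ _ h, univ_inter]

theorem naturalParameterization_arcLength (hγ : LipschitzWith K γ) (t : ℝ) :
    naturalParameterization γ univ 0 (arcLength γ t) = γ t :=
  edist_eq_zero.mp (edist_naturalParameterization_eq_zero (hγ.locallyBoundedVariationOn _)
    (mem_univ _) (mem_univ _))

theorem arcLength_add_period (hγ : LipschitzWith K γ) (hp : Function.Periodic γ T) (t : ℝ) :
    arcLength γ (t + T) = arcLength γ t + arcLength γ T := by
  have shift := variationOnFromTo.comp_eq_of_monotoneOn γ (t := univ) (fun r => r + T)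
    (fun x _ y _ hxy => by simpa using hxy) (mem_univ 0) (mem_univ t)
  rw [show γ ∘ (fun r => r + T) = γ from funext hp, image_univ,
    (add_right_surjective T).range_eq, zero_add] at shift
  rw [arcLength, shift, add_comm (variationOnFromTo _ _ _ _)]
  exact (variationOnFromTo.add (hγ.locallyBoundedVariationOn _) (mem_univ 0)
    (mem_univ T) (mem_univ (t + T))).symm

theorem arcLength_pos (hγ : LipschitzWith K γ) {r : ℝ} (hr : 0 ≤ r) (hrT : r ≤ T)
    (hne : γ 0 ≠ γ r) : 0 < arcLength γ T := by
  rw [arcLength_of_nonneg γ (hr.trans hrT)]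
  refine ENNReal.toReal_pos ?_
    ((eVariationOn_Icc_le_of_lipschitz hγ 0 T).trans_lt (by finiteness)).ne
  exact ((edist_pos.mpr hne).trans_le
    (eVariationOn.edist_le γ (left_mem_Icc.mpr (hr.trans hrT)) ⟨hr, hrT⟩)).ne'

theorem surjective_arcLength (hγ : LipschitzWith K γ) (hp : Function.Periodic γ T)
    (hlength : 0 < arcLength γ T) : Function.Surjective (arcLength γ) := by
  have zsmul_period : ∀ n : ℤ, arcLength γ (n • T) = n • arcLength γ T := fun n => by
    have := AddConstMapClass.map_zsmul_add
      (⟨arcLength γ, arcLength_add_period hγ hp⟩ : AddConstMap ℝ ℝ T (arcLength γ T)) n 0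
    simpa [show arcLength γ 0 = 0 from variationOnFromTo.self _ _ _] using this
  intro y
  obtain ⟨n, hn, -⟩ := existsUnique_zsmul_near_of_pos hlength y
  rw [← zsmul_period, ← zsmul_period] at hn
  exact mem_range_of_exists_le_of_exists_ge (continuous_arcLength hγ) ⟨_, hn.1⟩ ⟨_, hn.2.le⟩

theorem hasUnitSpeedOn_naturalParameterization (hγ : LipschitzWith K γ)
    (hs : Function.Surjective (arcLength γ)) :
    HasUnitSpeedOn (naturalParameterization γ univ 0) univ := by
  have := has_unit_speed_naturalParameterization γ (hγ.locallyBoundedVariationOn univ) (mem_univ 0)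
  rwa [image_univ, show range (variationOnFromTo γ univ 0) = univ from hs.range_eq] at this

end Parameterization

section Directions

theorem u_coe (θ : ℝ) : u θ = !₂[Real.cos θ, Real.sin θ] := by
  rw [u, Real.Angle.cos_coe, Real.Angle.sin_coe]

theorem inner_u (x : Plane) (θ : ℝ) : inner ℝ x (u θ) = radial x θ := by
  rw [u_coe, PiLp.inner_apply, Fin.sum_univ_two]
  simp [radial, mul_comm]

theorem norm_u (θ : ℝ) : ‖u θ‖ = 1 := by
  simp [u_coe, EuclideanSpace.norm_eq, Fin.sum_univ_two]

theorem norm_u_sub_le (s t : ℝ) : ‖u s - u t‖ ≤ |s - t| := by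
  refine abs_le_of_sq_le_sq' ?_ (abs_nonneg _) |>.2
  have hcos := Real.one_sub_sq_div_two_le_cos (x := s - t)
  rw [norm_sub_sq_real, norm_u, norm_u, inner_u, u_coe, sq_abs]
  rw [Real.cos_sub] at hcos
  simp only [radial, Matrix.cons_val_zero, Matrix.cons_val_one]
  linarith

theorem radial_u (t θ : ℝ) : radial (u t) θ = Real.cos (t - θ) := by
  rw [u_coe, Real.cos_sub]
  simp [radial]

theorem radial_smul (r : ℝ) (x : Plane) (θ : ℝ) : radial (r • x) θ = r * radial x θ := by
  simp only [radial, PiLp.smul_apply, smul_eq_mul]; ring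

theorem tangential_smul (r : ℝ) (x : Plane) (θ : ℝ) :
    tangential (r • x) θ = r * tangential x θ := by
  simp only [tangential, PiLp.smul_apply, smul_eq_mul]; ring

theorem continuous_radial_left (θ : ℝ) : Continuous fun x : Plane => radial x θ := by
  unfold radial; fun_prop

theorem exists_eq_norm_mul_radial (f : Plane →L[ℝ] ℝ) : ∃ θ, ∀ y, f y = ‖f‖ * radial y θ := by
  obtain ⟨v, rfl⟩ := (InnerProductSpace.toDual ℝ Plane).surjective f
  set z : ℂ := ⟨v 0, v 1⟩
  have hnorm : ‖z‖ = ‖v‖ := by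
    rw [Complex.norm_def, EuclideanSpace.norm_eq, Complex.normSq_apply, Fin.sum_univ_two]
    simp only [z, Real.norm_eq_abs, sq_abs, ← pow_two]
  refine ⟨z.arg, fun y => ?_⟩
  have hcos : ‖v‖ * Real.cos z.arg = v 0 := hnorm ▸ Complex.norm_mul_cos_arg z
  have hsin : ‖v‖ * Real.sin z.arg = v 1 := hnorm ▸ Complex.norm_mul_sin_arg z
  rw [InnerProductSpace.toDual_apply_apply, LinearIsometryEquiv.norm_map, PiLp.inner_apply,
    Fin.sum_univ_two, radial, ← hcos, ← hsin]
  simp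
  ring

end Directions

section Support

/-- The support function of `C` in the sense of an infimum, as a function of a real angle. -/
def support (C : Set Plane) (θ : ℝ) : ℝ := supportInf C θ

/-- The Minkowski functional of `C` seen from its center. -/
def bodyGauge (C : Set Plane) : Plane → ℝ := gauge ((fun x => x - center C) '' C)

/-- The convex set `C` contains the closed `δ`-ball around its center and is contained in the closed
`M`-ball. This quantitative form of `IsConvexBody` provides the constants of all estimates. -/
structure HasRadii (C : Set Plane) (δ M : ℝ) : Prop where
  convex : Convex ℝ C
  pos : 0 < δ
  closedBall_subset : Metric.closedBall (center C) δ ⊆ C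
  norm_le : ∀ y ∈ C, ‖y - center C‖ ≤ M

theorem IsConvexBody.exists_hasRadii {C : Set Plane} (hC : IsConvexBody C) :
    ∃ δ M, HasRadii C δ M := by
  have hcenter : center C ∈ interior C := Classical.epsilon_spec hC.nonempty_interior
  obtain ⟨δ, hδ, hball⟩ :=
    Metric.nhds_basis_closedBall.mem_iff.mp (mem_interior_iff_mem_nhds.mp hcenter)
  obtain ⟨M, hM⟩ := hC.isBounded.subset_closedBall (center C)
  exact ⟨δ, M, hC.convex, hδ, hball, fun y hy => mem_closedBall_iff_norm.mp (hM hy)⟩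

theorem periodic_support (C : Set Plane) : Function.Periodic (support C) (2 * π) := fun θ => by
  rw [support, support, Real.Angle.coe_add, Real.Angle.coe_two_pi, add_zero]

variable {C : Set Plane} {δ M : ℝ}

namespace HasRadii

theorem center_mem (hC : HasRadii C δ M) : center C ∈ C :=
  hC.closedBall_subset (Metric.mem_closedBall_self hC.pos.le)

theorem center_sub_smul_u_mem (hC : HasRadii C δ M) (θ : ℝ) : center C - δ • u θ ∈ C := by
  refine hC.closedBall_subset ?_
  rw [mem_closedBall_iff_norm, sub_sub_cancel_left, norm_neg, norm_smul, norm_u, mul_one,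
    Real.norm_of_nonneg hC.pos.le]

theorem outer_pos (hC : HasRadii C δ M) : 0 < M := by
  have h := hC.norm_le _ (hC.center_sub_smul_u_mem 0)
  rw [sub_sub_cancel_left, norm_neg, norm_smul, norm_u, mul_one,
    Real.norm_of_nonneg hC.pos.le] at h
  exact hC.pos.trans_le h

theorem nonempty_interior (hC : HasRadii C δ M) : (interior C).Nonempty :=
  ⟨center C, mem_interior_iff_mem_nhds.mpr
    (mem_of_superset (Metric.closedBall_mem_nhds _ hC.pos) hC.closedBall_subset)⟩

theorem bddBelow_inner (hC : HasRadii C δ M) (θ : ℝ) :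
    BddBelow (range fun y : C => inner ℝ (y : Plane) (u θ)) := by
  refine ⟨radial (center C) θ - M, ?_⟩
  rintro _ ⟨⟨y, hy⟩, rfl⟩
  have h := (abs_le.mp ((abs_radial_le (y - center C) θ).trans (hC.norm_le y hy))).1
  rw [radial_sub] at h
  simp only [inner_u]
  linarith

theorem support_le (hC : HasRadii C δ M) {y : Plane} (hy : y ∈ C) (θ : ℝ) :
    support C θ ≤ radial y θ := by
  rw [← inner_u]
  exact ciInf_le (hC.bddBelow_inner θ) (⟨y, hy⟩ : C)

theorem le_support (hC : HasRadii C δ M) {r θ : ℝ} (h : ∀ y ∈ C, r ≤ radial y θ) :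
    r ≤ support C θ := by
  have : Nonempty C := ⟨⟨_, hC.center_mem⟩⟩
  refine le_ciInf fun y => ?_
  rw [inner_u]
  exact h y y.2

theorem support_le_of_mem_closure (hC : HasRadii C δ M) {y : Plane} (hy : y ∈ closure C) (θ : ℝ) :
    support C θ ≤ radial y θ :=
  closure_minimal (t := {y | support C θ ≤ radial y θ}) (fun _ hx => hC.support_le hx θ)
    (isClosed_le continuous_const (continuous_radial_left θ)) hy

theorem support_add_le (hC : HasRadii C δ M) (θ : ℝ) :
    support C θ + δ ≤ radial (center C) θ := by
  have h := hC.support_le (hC.center_sub_smul_u_mem θ) θ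
  rw [radial_sub, radial_smul, radial_u, sub_self, Real.cos_zero] at h
  linarith

theorem norm_le_of_mem (hC : HasRadii C δ M) {y : Plane} (hy : y ∈ C) :
    ‖y‖ ≤ M + ‖center C‖ := by
  calc ‖y‖ = ‖y - center C + center C‖ := by rw [sub_add_cancel]
    _ ≤ ‖y - center C‖ + ‖center C‖ := norm_add_le _ _
    _ ≤ M + ‖center C‖ := by gcongr; exact hC.norm_le y hy

theorem lipschitz_support (hC : HasRadii C δ M) : ∃ K, LipschitzWith K (support C) := by
  have hK : 0 ≤ M + ‖center C‖ := add_nonneg hC.outer_pos.le (norm_nonneg _)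
  refine ⟨.mk _ hK, LipschitzWith.of_le_add_mul _ fun θ θ' => ?_⟩
  rw [← sub_le_iff_le_add]
  refine hC.le_support fun y hy => ?_
  have h := (le_abs_self _).trans ((lipschitzWith_radial y).dist_le_mul θ θ')
  have hy' : ‖y‖ * dist θ θ' ≤ (M + ‖center C‖) * dist θ θ' := by
    gcongr
    exact hC.norm_le_of_mem hy
  rw [coe_nnnorm] at h
  rw [NNReal.coe_mk]
  linarith [hC.support_le hy θ]

theorem support_concave (hC : HasRadii C δ M) (x y z : ℝ) (hxy : x ≤ y) (hyz : y ≤ z)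
    (hzx : z ≤ x + π) :
    support C x * Real.sin (z - y) + support C z * Real.sin (y - x)
      ≤ support C y * Real.sin (z - x) := by
  have sin_nonneg : ∀ {t}, 0 ≤ t → t ≤ π → 0 ≤ Real.sin t := Real.sin_nonneg_of_nonneg_of_le_pi
  have hsin : 0 ≤ Real.sin (z - x) := sin_nonneg (by linarith) (by linarith)
  have le_radial_mul : ∀ p ∈ C, support C x * Real.sin (z - y) + support C z * Real.sin (y - x)
      ≤ radial p y * Real.sin (z - x) := by
    intro p hp
    rw [radial_mul_sin]
    gcongr
    · exact sin_nonneg (by linarith) (by linarith)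
    · exact hC.support_le hp x
    · exact sin_nonneg (by linarith) (by linarith)
    · exact hC.support_le hp z
  rcases hsin.eq_or_lt with hzero | hpos
  · simpa only [← hzero, mul_zero] using le_radial_mul _ hC.center_mem
  · rw [← div_le_iff₀ hpos]
    exact hC.le_support fun p hp => (div_le_iff₀ hpos).mpr (le_radial_mul p hp)

theorem exists_radial_le (hC : HasRadii C δ M) {x : Plane} (hx : x ∉ interior C) :
    ∃ θ, ∀ y ∈ C, radial x θ ≤ radial y θ := by
  obtain ⟨f, hf⟩ := geometric_hahn_banach_point_open hC.convex.interior isOpen_interior hx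
  have hle : ∀ y ∈ C, f x ≤ f y := by
    intro y hy
    refine closure_minimal (t := {y | f x ≤ f y}) (fun z hz => (hf z hz).le)
      (isClosed_le continuous_const f.continuous) ?_
    rw [hC.convex.closure_interior_eq_closure_of_nonempty_interior hC.nonempty_interior]
    exact subset_closure hy
  have hne : f ≠ 0 := by
    rintro rfl
    obtain ⟨z, hz⟩ := hC.nonempty_interior
    exact lt_irrefl _ (hf z hz)
  obtain ⟨θ, hθ⟩ := exists_eq_norm_mul_radial f
  refine ⟨θ, fun y hy => le_of_mul_le_mul_left ?_ (norm_pos_iff.mpr hne)⟩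
  rw [← hθ, ← hθ]
  exact hle y hy

theorem exists_support_eq (hC : HasRadii C δ M) {x : Plane} (hx : x ∈ closure C)
    (hx' : x ∉ interior C) : ∃ θ, support C θ = radial x θ := by
  obtain ⟨θ, hθ⟩ := hC.exists_radial_le hx'
  exact ⟨θ, le_antisymm (hC.support_le_of_mem_closure hx θ) (hC.le_support hθ)⟩

end HasRadii

theorem bodyGauge_smul {r : ℝ} (hr : 0 ≤ r) (x : Plane) :
    bodyGauge C (r • x) = r * bodyGauge C x :=
  gauge_smul_of_nonneg hr x

namespace HasRadii

theorem convex_shift (hC : HasRadii C δ M) : Convex ℝ ((fun x => x - center C) '' C) := by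
  simpa only [neg_add_eq_sub] using hC.convex.translate (-center C)

theorem closedBall_subset_shift (hC : HasRadii C δ M) :
    Metric.closedBall 0 δ ⊆ (fun x => x - center C) '' C := fun x hx =>
  ⟨x + center C, hC.closedBall_subset (by simpa [mem_closedBall_iff_norm] using hx),
    add_sub_cancel_right _ _⟩

theorem shift_mem_nhds (hC : HasRadii C δ M) : (fun x => x - center C) '' C ∈ 𝓝 (0 : Plane) :=
  mem_of_superset (Metric.closedBall_mem_nhds _ hC.pos) hC.closedBall_subset_shift

theorem shift_subset_closedBall (hC : HasRadii C δ M) :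
    (fun x => x - center C) '' C ⊆ Metric.closedBall 0 M := by
  rintro _ ⟨x, hx, rfl⟩
  simpa using hC.norm_le x hx

theorem mem_closure_iff (hC : HasRadii C δ M) (x : Plane) :
    x ∈ closure C ↔ bodyGauge C (x - center C) ≤ 1 := by
  rw [bodyGauge, gauge_le_one_iff_mem_closure hC.convex_shift hC.shift_mem_nhds]
  change _ ↔ _ ∈ closure (Homeomorph.subRight (center C) '' C)
  rw [← Homeomorph.image_closure]
  simp

theorem mem_interior_iff (hC : HasRadii C δ M) (x : Plane) :
    x ∈ interior C ↔ bodyGauge C (x - center C) < 1 := by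
  rw [bodyGauge, gauge_lt_one_iff_mem_interior hC.convex_shift hC.shift_mem_nhds]
  change _ ↔ _ ∈ interior (Homeomorph.subRight (center C) '' C)
  rw [← Homeomorph.image_interior]
  simp

theorem bodyGauge_add_le (hC : HasRadii C δ M) (x y : Plane) :
    bodyGauge C (x + y) ≤ bodyGauge C x + bodyGauge C y :=
  gauge_add_le hC.convex_shift (absorbent_nhds_zero hC.shift_mem_nhds) x y

theorem lipschitz_bodyGauge (hC : HasRadii C δ M) :
    LipschitzWith δ.toNNReal⁻¹ (bodyGauge C) := by
  refine hC.convex_shift.lipschitzWith_gauge (Real.toNNReal_pos.mpr hC.pos) ?_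
  rw [Real.coe_toNNReal _ hC.pos.le]
  exact Metric.ball_subset_closedBall.trans hC.closedBall_subset_shift

theorem norm_div_le_bodyGauge (hC : HasRadii C δ M) (x : Plane) : ‖x‖ / M ≤ bodyGauge C x :=
  le_gauge_of_subset_closedBall (absorbent_nhds_zero hC.shift_mem_nhds) hC.outer_pos.le
    hC.shift_subset_closedBall

theorem bodyGauge_u_pos (hC : HasRadii C δ M) (t : ℝ) : 0 < bodyGauge C (u t) := by
  have h := hC.norm_div_le_bodyGauge (u t)
  rw [norm_u] at h
  exact (one_div_pos.mpr hC.outer_pos).trans_le h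

theorem inv_bodyGauge_u_le (hC : HasRadii C δ M) (t : ℝ) : (bodyGauge C (u t))⁻¹ ≤ M := by
  have h := hC.norm_div_le_bodyGauge (u t)
  rw [norm_u, one_div] at h
  exact inv_le_of_inv_le₀ hC.outer_pos h

end HasRadii

end Support

section PolarCurve

variable {C : Set Plane} {δ M : ℝ}

theorem polarCurve_sub_center (C : Set Plane) (t : ℝ) :
    polarCurve C t - center C = (bodyGauge C (u t))⁻¹ • u t :=
  add_sub_cancel_left _ _

theorem periodic_polarCurve (C : Set Plane) : Function.Periodic (polarCurve C) (2 * π) :=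
  fun t => by rw [polarCurve, polarCurve, Real.Angle.coe_add, Real.Angle.coe_two_pi, add_zero]

theorem cross_polarCurve (C : Set Plane) (s t : ℝ) :
    (polarCurve C s - center C) 0 * (polarCurve C t - center C) 1
      - (polarCurve C s - center C) 1 * (polarCurve C t - center C) 0
      = (bodyGauge C (u s))⁻¹ * (bodyGauge C (u t))⁻¹ * Real.sin (t - s) := by
  rw [polarCurve_sub_center, polarCurve_sub_center, u_coe, u_coe, Real.sin_sub]
  simp
  ring

namespace HasRadii

theorem norm_polarCurve_sub_center_le (hC : HasRadii C δ M) (t : ℝ) :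
    ‖polarCurve C t - center C‖ ≤ M := by
  rw [polarCurve_sub_center, norm_smul, norm_u, mul_one, norm_inv,
    Real.norm_of_nonneg (hC.bodyGauge_u_pos t).le]
  exact hC.inv_bodyGauge_u_le t

theorem bodyGauge_polarCurve (hC : HasRadii C δ M) (t : ℝ) :
    bodyGauge C (polarCurve C t - center C) = 1 := by
  rw [polarCurve_sub_center, bodyGauge_smul (inv_nonneg.mpr (hC.bodyGauge_u_pos t).le),
    inv_mul_cancel₀ (hC.bodyGauge_u_pos t).ne']

theorem polarCurve_mem_closure (hC : HasRadii C δ M) (t : ℝ) : polarCurve C t ∈ closure C :=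
  (hC.mem_closure_iff _).mpr (hC.bodyGauge_polarCurve t).le

theorem polarCurve_notMem_interior (hC : HasRadii C δ M) (t : ℝ) :
    polarCurve C t ∉ interior C := by
  rw [hC.mem_interior_iff, hC.bodyGauge_polarCurve]
  exact lt_irrefl 1

theorem abs_inv_bodyGauge_u_sub_le (hC : HasRadii C δ M) (s t : ℝ) :
    |(bodyGauge C (u s))⁻¹ - (bodyGauge C (u t))⁻¹| ≤ M * M * (δ⁻¹ * |s - t|) := by
  have hs := hC.bodyGauge_u_pos s
  have ht := hC.bodyGauge_u_pos t
  have hM := hC.outer_pos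
  have hgauge : |bodyGauge C (u s) - bodyGauge C (u t)| ≤ δ⁻¹ * |s - t| := by
    have h := hC.lipschitz_bodyGauge.dist_le_mul (u s) (u t)
    rw [NNReal.coe_inv, Real.coe_toNNReal _ hC.pos.le, Real.dist_eq, dist_eq_norm] at h
    exact h.trans (mul_le_mul_of_nonneg_left (norm_u_sub_le s t) (inv_nonneg.mpr hC.pos.le))
  rw [inv_sub_inv hs.ne' ht.ne', abs_div, abs_sub_comm, abs_of_pos (mul_pos hs ht), div_eq_inv_mul,
    mul_inv]
  gcongr
  · exact hC.inv_bodyGauge_u_le s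
  · exact hC.inv_bodyGauge_u_le t

theorem lipschitz_polarCurve (hC : HasRadii C δ M) : ∃ K, LipschitzWith K (polarCurve C) := by
  have hM := hC.outer_pos
  have hδ := hC.pos
  refine ⟨(M + M * M * δ⁻¹).toNNReal, LipschitzWith.of_dist_le_mul fun s t => ?_⟩
  rw [Real.coe_toNNReal _ (by positivity), dist_eq_norm, Real.dist_eq]
  have hsplit : polarCurve C s - polarCurve C t = (bodyGauge C (u s))⁻¹ • (u s - u t)
      + ((bodyGauge C (u s))⁻¹ - (bodyGauge C (u t))⁻¹) • u t := by
    rw [← sub_sub_sub_cancel_right _ _ (center C), polarCurve_sub_center, polarCurve_sub_center]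
    module
  calc ‖polarCurve C s - polarCurve C t‖
      ≤ ‖(bodyGauge C (u s))⁻¹ • (u s - u t)‖
        + ‖((bodyGauge C (u s))⁻¹ - (bodyGauge C (u t))⁻¹) • u t‖ := hsplit ▸ norm_add_le _ _
    _ = (bodyGauge C (u s))⁻¹ * ‖u s - u t‖
        + |(bodyGauge C (u s))⁻¹ - (bodyGauge C (u t))⁻¹| := by
        rw [norm_smul, norm_smul, norm_u, mul_one, Real.norm_eq_abs, Real.norm_eq_abs,
          abs_of_pos (inv_pos.mpr (hC.bodyGauge_u_pos s))]
    _ ≤ M * |s - t| + M * M * (δ⁻¹ * |s - t|) := by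
        gcongr
        · exact hC.inv_bodyGauge_u_le s
        · exact norm_u_sub_le s t
        · exact hC.abs_inv_bodyGauge_u_sub_le s t
    _ = (M + M * M * δ⁻¹) * |s - t| := by ring

theorem polarCurve_ne_polarCurve_add_pi (hC : HasRadii C δ M) (t : ℝ) :
    polarCurve C t ≠ polarCurve C (t + π) := by
  intro h
  have hradial := congrArg (fun x => radial (x - center C) t) h
  simp only [polarCurve_sub_center, radial_smul, radial_u, sub_self, Real.cos_zero,
    add_sub_cancel_left, Real.cos_pi] at hradial
  linarith [inv_pos.mpr (hC.bodyGauge_u_pos t), inv_pos.mpr (hC.bodyGauge_u_pos (t + π))]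

end HasRadii

end PolarCurve

section ArcParam

variable {C : Set Plane} {δ M : ℝ}

theorem perimeter_eq_arcLength (C : Set Plane) :
    perimeter C = arcLength (polarCurve C) (2 * π) :=
  (arcLength_of_nonneg _ Real.two_pi_pos.le).symm

theorem nonneg_of_hasDerivAt_of_eventually_nonneg {φ : ℝ → ℝ} {φ' x : ℝ}
    (hφ : HasDerivAt φ φ' x) (hx : φ x = 0) (hnonneg : ∀ᶠ r in 𝓝[>] x, 0 ≤ φ r) : 0 ≤ φ' := by
  refine ge_of_tendsto ((hasDerivWithinAt_iff_tendsto_slope' self_notMem_Ioi).mp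
    hφ.hasDerivWithinAt) ?_
  filter_upwards [hnonneg, self_mem_nhdsWithin] with r hr hxr
  rw [slope_def_field, hx, sub_zero]
  exact div_nonneg hr (sub_nonneg.mpr (mem_Ioi.mp hxr).le)

namespace HasRadii

theorem arcParam_arcLength (hC : HasRadii C δ M) (t : ℝ) :
    arcParam C (arcLength (polarCurve C) t) = polarCurve C t :=
  let ⟨_, hK⟩ := hC.lipschitz_polarCurve
  naturalParameterization_arcLength hK t

theorem perimeter_pos (hC : HasRadii C δ M) : 0 < perimeter C := by
  obtain ⟨K, hK⟩ := hC.lipschitz_polarCurve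
  rw [perimeter_eq_arcLength]
  refine arcLength_pos hK Real.pi_pos.le (by linarith [Real.pi_pos]) ?_
  simpa only [zero_add] using hC.polarCurve_ne_polarCurve_add_pi 0

theorem surjective_arcLength_polarCurve (hC : HasRadii C δ M) :
    Function.Surjective (arcLength (polarCurve C)) :=
  let ⟨_, hK⟩ := hC.lipschitz_polarCurve
  surjective_arcLength hK (periodic_polarCurve C) (perimeter_eq_arcLength C ▸ hC.perimeter_pos)

theorem exists_arcParam_eq_polarCurve (hC : HasRadii C δ M) (s : ℝ) :
    ∃ t, arcParam C s = polarCurve C t := by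
  obtain ⟨t, rfl⟩ := hC.surjective_arcLength_polarCurve s
  exact ⟨t, hC.arcParam_arcLength t⟩

theorem arcLength_add_two_pi (hC : HasRadii C δ M) (t : ℝ) :
    arcLength (polarCurve C) (t + 2 * π) = arcLength (polarCurve C) t + perimeter C := by
  obtain ⟨K, hK⟩ := hC.lipschitz_polarCurve
  rw [arcLength_add_period hK (periodic_polarCurve C), perimeter_eq_arcLength]

theorem periodic_arcParam (hC : HasRadii C δ M) :
    Function.Periodic (arcParam C) (perimeter C) := by
  intro s
  obtain ⟨t, rfl⟩ := hC.surjective_arcLength_polarCurve s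
  rw [← hC.arcLength_add_two_pi, hC.arcParam_arcLength, hC.arcParam_arcLength,
    periodic_polarCurve C t]

theorem hasUnitSpeedOn_arcParam (hC : HasRadii C δ M) : HasUnitSpeedOn (arcParam C) univ :=
  let ⟨_, hK⟩ := hC.lipschitz_polarCurve
  hasUnitSpeedOn_naturalParameterization hK hC.surjective_arcLength_polarCurve

theorem lipschitz_arcParam (hC : HasRadii C δ M) : LipschitzWith 1 (arcParam C) :=
  lipschitzWith_of_hasUnitSpeedOn hC.hasUnitSpeedOn_arcParam

theorem eventually_cross_arcParam_nonneg (hC : HasRadii C δ M) (s : ℝ) :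
    ∀ᶠ r in 𝓝[>] s, 0 ≤ (arcParam C s - center C) 0 * (arcParam C r - center C) 1
      - (arcParam C s - center C) 1 * (arcParam C r - center C) 0 := by
  obtain ⟨K, hK⟩ := hC.lipschitz_polarCurve
  obtain ⟨t, rfl⟩ := hC.surjective_arcLength_polarCurve s
  have hle : t ≤ t + π := by linarith [Real.pi_pos]
  have hlt : arcLength (polarCurve C) t < arcLength (polarCurve C) (t + π) := by
    refine (monotone_arcLength hK hle).lt_of_ne fun h => hC.polarCurve_ne_polarCurve_add_pi t ?_
    rw [← hC.arcParam_arcLength, h, hC.arcParam_arcLength]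
  filter_upwards [Ioo_mem_nhdsGT hlt] with r hr
  obtain ⟨t', ht', rfl⟩ := intermediate_value_Icc hle (continuous_arcLength hK).continuousOn
    (Ioo_subset_Icc_self hr)
  rw [hC.arcParam_arcLength, hC.arcParam_arcLength, cross_polarCurve]
  have hsin := Real.sin_nonneg_of_nonneg_of_le_pi (sub_nonneg.mpr ht'.1) (by linarith [ht'.2])
  have ht := hC.bodyGauge_u_pos t
  have ht' := hC.bodyGauge_u_pos t'
  positivity

theorem cross_deriv_arcParam_nonneg (hC : HasRadii C δ M) {s : ℝ}
    (hd : DifferentiableAt ℝ (arcParam C) s) :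
    0 ≤ (arcParam C s - center C) 0 * (deriv (arcParam C) s) 1
      - (arcParam C s - center C) 1 * (deriv (arcParam C) s) 0 := by
  have hX := hd.hasDerivAt.sub_const (center C)
  exact nonneg_of_hasDerivAt_of_eventually_nonneg
    (((hasDerivAt_coord hX 1).const_mul _).sub ((hasDerivAt_coord hX 0).const_mul _))
    (by simp only [Pi.sub_apply]; ring) (hC.eventually_cross_arcParam_nonneg s)

theorem isSupportedCurve (hC : HasRadii C δ M) :
    IsSupportedCurve (arcParam C) (support C) (center C) δ M where
  pos := hC.pos
  lipschitz := hC.lipschitz_arcParam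
  speed := ae_norm_deriv_eq_one hC.hasUnitSpeedOn_arcParam
  orient := hC.lipschitz_arcParam.ae_differentiableAt_real.mono fun _ hs =>
    hC.cross_deriv_arcParam_nonneg hs
  periodic := periodic_support C
  lipschitz_support := hC.lipschitz_support
  le_radial s θ := by
    obtain ⟨t, ht⟩ := hC.exists_arcParam_eq_polarCurve s
    exact ht ▸ hC.support_le_of_mem_closure (hC.polarCurve_mem_closure t) θ
  touch s := by
    obtain ⟨t, ht⟩ := hC.exists_arcParam_eq_polarCurve s
    exact ht ▸ hC.exists_support_eq (hC.polarCurve_mem_closure t) (hC.polarCurve_notMem_interior t)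
  concave := hC.support_concave
  deep := hC.support_add_le
  bounded s := by
    obtain ⟨t, ht⟩ := hC.exists_arcParam_eq_polarCurve s
    exact ht ▸ hC.norm_polarCurve_sub_center_le t

end HasRadii

end ArcParam

section ConvexSublevel

variable {E : Type*} [AddCommGroup E] [Module ℝ E] [TopologicalSpace E] [IsTopologicalAddGroup E]
  [ContinuousSMul ℝ E] {r : ℝ}

theorem closure_setOf_lt_eq_of_convexOn {g : E → ℝ} (hconv : ConvexOn ℝ univ g)
    (hcont : Continuous g) {x₀ : E} (h₀ : g x₀ < r) : closure {x | g x < r} = {x | g x ≤ r} := by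
  refine (closure_lt_subset_le hcont continuous_const).antisymm fun x hx => ?_
  refine closure_mono ?_ (segment_subset_closure_openSegment (left_mem_segment ℝ x x₀))
  rintro _ ⟨p, q, hp, hq, hpq, rfl⟩
  calc g (p • x + q • x₀) ≤ p • g x + q • g x₀ :=
        hconv.2 (mem_univ x) (mem_univ x₀) hp.le hq.le hpq
    _ < p • r + q • r := add_lt_add_of_le_of_lt
        (smul_le_smul_of_nonneg_left hx hp.le) (smul_lt_smul_of_pos_left h₀ hq)
    _ = r := by rw [← add_smul, hpq, one_smul]

theorem exists_sublevel_eq_Icc_of_convexOn {g : ℝ → ℝ} (hconv : ConvexOn ℝ univ g)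
    (hcont : Continuous g) {x₀ : ℝ} (h₀ : g x₀ < r) (hbdd : Bornology.IsBounded {x | g x ≤ r}) :
    ∃ y₁ y₂, y₁ ≤ y₂ ∧ {x | g x ≤ r} = Icc y₁ y₂ ∧ {x | g x < r} = Ioo y₁ y₂ := by
  have hle : Convex ℝ {x | g x ≤ r} := by simpa using hconv.convex_le r
  have hlt : Convex ℝ {x | g x < r} := by simpa using hconv.convex_lt r
  have hopen : IsOpen {x | g x < r} := isOpen_lt hcont continuous_const
  have hcompact : IsCompact {x | g x ≤ r} :=
    Metric.isCompact_of_isClosed_isBounded (isClosed_le hcont continuous_const) hbdd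
  have hIcc := eq_Icc_of_connected_compact ⟨⟨x₀, h₀.le⟩, hle.isPreconnected⟩ hcompact
  have hmem : x₀ ∈ Icc (sInf {x | g x ≤ r}) (sSup {x | g x ≤ r}) := hIcc ▸ h₀.le
  refine ⟨_, _, hmem.1.trans hmem.2, hIcc, ?_⟩
  rw [← interior_Icc, ← hIcc, ← closure_setOf_lt_eq_of_convexOn hconv hcont h₀,
    hlt.interior_closure_eq_interior_of_nonempty_interior (hopen.interior_eq.symm ▸ ⟨x₀, h₀⟩),
    hopen.interior_eq]

end ConvexSublevel

section Frame

theorem tangential_u (t θ : ℝ) : tangential (u t) θ = Real.sin (t - θ) := by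
  rw [u_coe, Real.sin_sub]
  simp [tangential, mul_comm]

theorem tangential_add (x y : Plane) (θ : ℝ) :
    tangential (x + y) θ = tangential x θ + tangential y θ := by
  simp only [tangential, PiLp.add_apply]; ring

theorem eq_of_radial_eq_of_tangential_eq {x y : Plane} {θ : ℝ} (hr : radial x θ = radial y θ)
    (ht : tangential x θ = tangential y θ) : x = y := by
  have h := radial_sq_add_tangential_sq (x - y) θ
  rw [radial_sub, tangential_sub, hr, ht, sub_self, sub_self] at h
  rw [← sub_eq_zero, ← norm_eq_zero]
  exact pow_eq_zero_iff two_ne_zero |>.mp (by linarith)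

/-- The point with components `r` along `u(θ)` and `y` along `u'(θ)`. -/
def framePoint (θ r y : ℝ) : Plane := r • u θ + y • u (θ + π / 2 : ℝ)

variable (θ r y : ℝ)

theorem radial_framePoint : radial (framePoint θ r y) θ = r := by
  rw [framePoint, radial_add, radial_smul, radial_smul, radial_u, radial_u]
  simp

theorem tangential_framePoint : tangential (framePoint θ r y) θ = y := by
  rw [framePoint, tangential_add, tangential_smul, tangential_smul, tangential_u, tangential_u]
  simp

theorem framePoint_radial_tangential (x : Plane) :
    framePoint θ (radial x θ) (tangential x θ) = x :=
  eq_of_radial_eq_of_tangential_eq (radial_framePoint ..) (tangential_framePoint ..)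

theorem isometry_framePoint : Isometry (framePoint θ r) := by
  refine Isometry.of_dist_eq fun y z => ?_
  rw [dist_eq_norm, framePoint, framePoint, add_sub_add_left_eq_sub, ← sub_smul, norm_smul, norm_u,
    mul_one, Real.dist_eq, Real.norm_eq_abs]

theorem framePoint_mul_tan (D : ℝ) {ψ : ℝ} (hψ : Real.cos ψ ≠ 0) :
    framePoint θ (-D) (D * Real.tan ψ) = (D / Real.cos ψ) • u (θ + π - ψ : ℝ) := by
  have hangle : θ + π - ψ - θ = π - ψ := by ring
  apply eq_of_radial_eq_of_tangential_eq (θ := θ)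
  · rw [radial_framePoint, radial_smul, radial_u, hangle, Real.cos_pi_sub]
    field_simp
  · rw [tangential_framePoint, tangential_smul, tangential_u, hangle, Real.sin_pi_sub,
      Real.tan_eq_sin_div_cos]
    ring

theorem lt_mul_tan_iff {D ψ : ℝ} (hD : 0 < D) (hψ : ψ ∈ Ioo (-(π / 2)) (π / 2)) :
    y < D * Real.tan ψ ↔ Real.arctan (y / D) < ψ := by
  rw [← div_lt_iff₀' hD, ← Real.arctan_strictMono.lt_iff_lt, Real.arctan_tan hψ.1 hψ.2]

theorem mul_tan_lt_iff {D ψ : ℝ} (hD : 0 < D) (hψ : ψ ∈ Ioo (-(π / 2)) (π / 2)) :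
    D * Real.tan ψ < y ↔ ψ < Real.arctan (y / D) := by
  rw [← lt_div_iff₀' hD, ← Real.arctan_strictMono.lt_iff_lt, Real.arctan_tan hψ.1 hψ.2]

end Frame

section Chord

variable {C : Set Plane} {δ M θ lam D : ℝ}

/-- The distance from the center of `C` to the line of the chord in direction `θ` at distance
`lam`. -/
def depth (C : Set Plane) (θ lam : ℝ) : ℝ := radial (center C) θ - support C θ - lam

/-- The gauge of `C` along the line of a chord, as a function of the tangential component measured
from the center. -/
def chordGauge (C : Set Plane) (θ lam y : ℝ) : ℝ :=
  bodyGauge C (framePoint θ (-depth C θ lam) y)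

/-- The chord of `C` in direction `θ` at distance `lam` ends at the points of `∂C` of polar angles
`t₁` and `t₂`, between which `∂C` runs through the cap cut off by the chord. -/
structure IsCap (C : Set Plane) (θ lam t₁ t₂ : ℝ) : Prop where
  le_left : θ ≤ t₁
  left_le_right : t₁ ≤ t₂
  right_le : t₂ ≤ θ + 2 * π
  radial_lt_iff : ∀ t ∈ Icc θ (θ + 2 * π),
    radial (polarCurve C t) θ < support C θ + lam ↔ t ∈ Ioo t₁ t₂
  tangential_le : tangential (polarCurve C t₂) θ ≤ tangential (polarCurve C t₁) θ
  chordLength_eq : chordLength C θ lam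
    = tangential (polarCurve C t₁) θ - tangential (polarCurve C t₂) θ
  tangential_mem : ∀ x ∈ closure C, radial x θ = support C θ + lam →
    tangential x θ ∈ Icc (tangential (polarCurve C t₂) θ) (tangential (polarCurve C t₁) θ)

theorem center_add_framePoint {x : Plane} (hx : radial x θ = support C θ + lam) :
    center C + framePoint θ (-depth C θ lam) (tangential x θ - tangential (center C) θ) = x := by
  rw [depth, show -(radial (center C) θ - support C θ - lam) = radial (x - center C) θ by
    rw [radial_sub, hx]; ring, ← tangential_sub, framePoint_radial_tangential, add_sub_cancel]

theorem chord_eq_image : chord C θ lam =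
    (fun y => center C + framePoint θ (-depth C θ lam) y) ''
      {y | center C + framePoint θ (-depth C θ lam) y ∈ C} := by
  ext x
  simp only [chord, inner_u, mem_ofPred_eq, mem_image]
  constructor
  · rintro ⟨hx, hxr⟩
    have heq := center_add_framePoint hxr
    exact ⟨_, heq.symm ▸ hx, heq⟩
  · rintro ⟨y, hy, rfl⟩
    refine ⟨hy, ?_⟩
    rw [radial_add, radial_framePoint, depth, support]
    ring

theorem polarCurve_eq_of_bodyGauge_eq_one {r t : ℝ} (hr : 0 ≤ r)
    (h : bodyGauge C (r • u t) = 1) : polarCurve C t = center C + r • u t := by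
  rw [bodyGauge_smul hr] at h
  rw [← sub_eq_iff_eq_add', polarCurve_sub_center, inv_eq_of_mul_eq_one_left h]

theorem polarCurve_eq_center_add_framePoint {y : ℝ} (hD : 0 < D)
    (h : bodyGauge C (framePoint θ (-D) y) = 1) :
    polarCurve C (θ + π - Real.arctan (y / D)) = center C + framePoint θ (-D) y := by
  have hcos := Real.cos_arctan_pos (y / D)
  have hy : framePoint θ (-D) y
      = (D / Real.cos (Real.arctan (y / D))) • u (θ + π - Real.arctan (y / D) : ℝ) := by
    rw [← framePoint_mul_tan θ D hcos.ne', Real.tan_arctan, mul_div_cancel₀ y hD.ne']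
  rw [hy] at h ⊢
  exact polarCurve_eq_of_bodyGauge_eq_one (div_pos hD hcos).le h

theorem radial_polarCurve (C : Set Plane) (t θ : ℝ) :
    radial (polarCurve C t) θ
      = radial (center C) θ + (bodyGauge C (u t))⁻¹ * Real.cos (t - θ) := by
  rw [← radial_u, ← radial_smul, ← polarCurve_sub_center, radial_sub, add_sub_cancel]

namespace HasRadii

theorem depth_pos (hC : HasRadii C δ M) (hlt : lam < δ) : 0 < depth C θ lam := by
  rw [depth]
  linarith [hC.support_add_le θ]

theorem convexOn_chordGauge (hC : HasRadii C δ M) (θ lam : ℝ) :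
    ConvexOn ℝ univ (chordGauge C θ lam) := by
  refine ⟨convex_univ, fun y _ z _ a b ha hb hab => ?_⟩
  have haffine : framePoint θ (-depth C θ lam) (a • y + b • z)
      = a • framePoint θ (-depth C θ lam) y + b • framePoint θ (-depth C θ lam) z := by
    obtain rfl : b = 1 - a := by linarith
    simp only [framePoint, smul_eq_mul]
    module
  rw [chordGauge, haffine, smul_eq_mul, smul_eq_mul, chordGauge, chordGauge, ← bodyGauge_smul ha,
    ← bodyGauge_smul hb]
  exact hC.bodyGauge_add_le _ _

theorem continuous_chordGauge (hC : HasRadii C δ M) (θ lam : ℝ) :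
    Continuous (chordGauge C θ lam) :=
  hC.lipschitz_bodyGauge.continuous.comp (isometry_framePoint θ _).continuous

theorem abs_le_of_chordGauge_le_one (hC : HasRadii C δ M) {y : ℝ}
    (hy : chordGauge C θ lam y ≤ 1) : |y| ≤ M := by
  have hnorm := (hC.norm_div_le_bodyGauge _).trans hy
  rw [div_le_one hC.outer_pos] at hnorm
  have htangential := (abs_tangential_le _ θ).trans hnorm
  rwa [tangential_framePoint] at htangential

theorem exists_chordGauge_lt_one (hC : HasRadii C δ M) (hlam : 0 < lam) (hlt : lam < δ) :
    ∃ y, chordGauge C θ lam y < 1 := by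
  obtain ⟨p, hp, hpr⟩ : ∃ p ∈ C, radial p θ < support C θ + lam := by
    by_contra! hcon
    linarith [hC.le_support hcon]
  have hD := hC.depth_pos (θ := θ) hlt
  have hpos : 0 < radial (center C) θ - radial p θ := by rw [depth] at hD; linarith
  -- the point of the segment from the center to `p` that lies on the line of the chord
  set μ := depth C θ lam / (radial (center C) θ - radial p θ) with hμ
  have hμ0 : 0 ≤ μ := (div_pos hD hpos).le
  have hμ1 : μ < 1 := (div_lt_one hpos).mpr (by rw [depth]; linarith)
  have hr : radial (μ • (p - center C)) θ = -depth C θ lam := by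
    rw [radial_smul, radial_sub, hμ]
    field_simp
    ring
  refine ⟨tangential (μ • (p - center C)) θ, ?_⟩
  calc chordGauge C θ lam (tangential (μ • (p - center C)) θ)
      = bodyGauge C (μ • (p - center C)) := by
        rw [chordGauge, ← hr, framePoint_radial_tangential]
    _ = μ * bodyGauge C (p - center C) := bodyGauge_smul hμ0 _
    _ ≤ μ * 1 := by gcongr; exact (hC.mem_closure_iff p).mp (subset_closure hp)
    _ < 1 := by rwa [mul_one]

theorem exists_chordGauge_sublevel_eq (hC : HasRadii C δ M) (hlam : 0 < lam) (hlt : lam < δ) :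
    ∃ y₁ y₂, y₁ ≤ y₂ ∧ {y | chordGauge C θ lam y ≤ 1} = Icc y₁ y₂ ∧
      {y | chordGauge C θ lam y < 1} = Ioo y₁ y₂ := by
  obtain ⟨y₀, hy₀⟩ := hC.exists_chordGauge_lt_one (θ := θ) hlam hlt
  refine exists_sublevel_eq_Icc_of_convexOn (hC.convexOn_chordGauge θ lam)
    (hC.continuous_chordGauge θ lam) hy₀ ((Metric.isBounded_Icc (-M) M).subset fun y hy => ?_)
  exact abs_le.mp (hC.abs_le_of_chordGauge_le_one hy)

variable {y₁ y₂ : ℝ}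

theorem chordLength_eq_sub (hC : HasRadii C δ M) (hy : y₁ ≤ y₂)
    (hle : {y | chordGauge C θ lam y ≤ 1} = Icc y₁ y₂)
    (hlt : {y | chordGauge C θ lam y < 1} = Ioo y₁ y₂) : chordLength C θ lam = y₂ - y₁ := by
  have hsub : {y | center C + framePoint θ (-depth C θ lam) y ∈ C} ⊆ Icc y₁ y₂ := by
    rw [← hle]
    intro y hy
    have h := (hC.mem_closure_iff _).mp (subset_closure hy)
    rwa [add_sub_cancel_left] at h
  have hsup : Ioo y₁ y₂ ⊆ {y | center C + framePoint θ (-depth C θ lam) y ∈ C} := by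
    rw [← hlt]
    intro y hy
    refine interior_subset (s := C) ((hC.mem_interior_iff _).mpr ?_)
    rwa [add_sub_cancel_left]
  have hiso : Isometry fun y => center C + framePoint θ (-depth C θ lam) y :=
    (IsometryEquiv.addLeft (center C)).isometry.comp (isometry_framePoint θ _)
  have hbdd := Metric.isBounded_Icc y₁ y₂
  rw [chordLength, chord_eq_image, hiso.diam_image]
  apply le_antisymm
  · exact (Metric.diam_mono hsub hbdd).trans_eq (Real.diam_Icc hy)
  · exact (Real.diam_Ioo hy).symm.trans_le (Metric.diam_mono hsup (hbdd.subset hsub))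

theorem radial_polarCurve_lt_iff (hC : HasRadii C δ M) {ψ : ℝ}
    (hψ : ψ ∈ Ioo (-(π / 2)) (π / 2)) (hD : 0 < depth C θ lam) :
    radial (polarCurve C (θ + π - ψ)) θ < support C θ + lam ↔
      chordGauge C θ lam (depth C θ lam * Real.tan ψ) < 1 := by
  have hcos := Real.cos_pos_of_mem_Ioo hψ
  rw [chordGauge, framePoint_mul_tan θ _ hcos.ne', bodyGauge_smul (div_pos hD hcos).le,
    radial_polarCurve, show θ + π - ψ - θ = π - ψ by ring, Real.cos_pi_sub, div_mul_eq_mul_div,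
    div_lt_one hcos, ← lt_div_iff₀ (hC.bodyGauge_u_pos _), ← inv_mul_eq_div, depth]
  constructor <;> intro h <;> linarith

theorem radial_polarCurve_lt_iff_mem_Ioo (hC : HasRadii C δ M) (hD : 0 < depth C θ lam)
    (hgauge : {y | chordGauge C θ lam y < 1} = Ioo y₁ y₂) {t : ℝ} (ht : t ∈ Icc θ (θ + 2 * π)) :
    radial (polarCurve C t) θ < support C θ + lam ↔
      t ∈ Ioo (θ + π - Real.arctan (y₂ / depth C θ lam))
        (θ + π - Real.arctan (y₁ / depth C θ lam)) := by
  by_cases hψ : θ + π - t ∈ Ioo (-(π / 2)) (π / 2)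
  · have h := hC.radial_polarCurve_lt_iff hψ hD
    rw [sub_sub_cancel] at h
    rw [h, ← mem_ofPred_eq (p := fun y => chordGauge C θ lam y < 1), hgauge, mem_Ioo,
      lt_mul_tan_iff _ hD hψ, mul_tan_lt_iff _ hD hψ, mem_Ioo, and_comm, sub_lt_comm, lt_sub_comm]
  · refine iff_of_false (not_lt.mpr ?_) fun hmem => hψ ?_
    · have hcos : 0 ≤ Real.cos (t - θ) := by
        rcases not_and_or.mp hψ with h | h
        · rw [← Real.cos_sub_two_pi]
          exact Real.cos_nonneg_of_mem_Icc ⟨by linarith, by linarith [ht.2]⟩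
        · exact Real.cos_nonneg_of_mem_Icc ⟨by linarith [ht.1], by linarith⟩
      have h := mul_nonneg (inv_pos.mpr (hC.bodyGauge_u_pos t)).le hcos
      rw [depth] at hD
      rw [radial_polarCurve]
      linarith
    · have h₁ := Real.neg_pi_div_two_lt_arctan (y₁ / depth C θ lam)
      have h₂ := Real.arctan_lt_pi_div_two (y₂ / depth C θ lam)
      exact ⟨by linarith [hmem.2], by linarith [hmem.1]⟩

theorem exists_isCap (hC : HasRadii C δ M) (θ : ℝ) (hlam : 0 < lam) (hlt : lam < δ) :
    ∃ t₁ t₂, IsCap C θ lam t₁ t₂ := by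
  obtain ⟨y₁, y₂, hy, hle, hgauge⟩ := hC.exists_chordGauge_sublevel_eq (θ := θ) hlam hlt
  have hD := hC.depth_pos (θ := θ) hlt
  have hpolar : ∀ y ∈ Icc y₁ y₂ \ Ioo y₁ y₂,
      tangential (polarCurve C (θ + π - Real.arctan (y / depth C θ lam))) θ
        = tangential (center C) θ + y := by
    rw [← hle, ← hgauge]
    rintro y ⟨hy1, hy2⟩
    rw [polarCurve_eq_center_add_framePoint hD (le_antisymm hy1 (not_lt.mp hy2)), tangential_add,
      tangential_framePoint]
  have htangential₁ := hpolar y₁ (by simpa)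
  have htangential₂ := hpolar y₂ (by simpa)
  refine ⟨θ + π - Real.arctan (y₂ / depth C θ lam), θ + π - Real.arctan (y₁ / depth C θ lam),
    ?_, ?_, ?_, fun t ht => hC.radial_polarCurve_lt_iff_mem_Ioo hD hgauge ht, ?_, ?_, ?_⟩
  · linarith [Real.arctan_lt_pi_div_two (y₂ / depth C θ lam), Real.pi_pos]
  · gcongr
  · linarith [Real.neg_pi_div_two_lt_arctan (y₁ / depth C θ lam), Real.pi_pos]
  · rw [htangential₁, htangential₂]
    gcongr
  · rw [htangential₁, htangential₂, hC.chordLength_eq_sub hy hle hgauge]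
    ring
  · intro x hx hxr
    have hmem : tangential x θ - tangential (center C) θ ∈ Icc y₁ y₂ := by
      rw [← hle, mem_ofPred_eq, chordGauge, ← add_sub_cancel_left (center C) (framePoint _ _ _),
        center_add_framePoint hxr, ← hC.mem_closure_iff]
      exact hx
    rw [htangential₁, htangential₂]
    exact ⟨by linarith [hmem.1], by linarith [hmem.2]⟩

end HasRadii

end Chord

section SignedSquare

theorem hasDerivAt_mul_abs_self (x : ℝ) : HasDerivAt (fun y : ℝ => y * |y|) (2 * |x|) x := by
  rcases lt_trichotomy x 0 with hx | rfl | hx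
  · refine ((hasDerivAt_id x).mul (hasDerivAt_abs_neg hx)).congr_deriv ?_
    rw [abs_of_neg hx, id]
    ring
  · have habs : Tendsto (fun y : ℝ => |y|) (𝓝[≠] 0) (𝓝 (2 * |0|)) := by
      simpa using (continuous_abs.tendsto (0 : ℝ)).mono_left nhdsWithin_le_nhds
    refine hasDerivAt_iff_tendsto_slope.mpr (habs.congr' ?_)
    filter_upwards [self_mem_nhdsWithin] with y hy
    rw [slope_def_field, zero_mul, sub_zero, sub_zero, mul_div_cancel_left₀ _ hy]
  · refine ((hasDerivAt_id x).mul (hasDerivAt_abs_pos hx)).congr_deriv ?_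
    rw [abs_of_pos hx, id]
    ring

theorem integral_abs_eq (p q : ℝ) : ∫ y in p..q, |y| = (q * |q| - p * |p|) / 2 := by
  have hint := intervalIntegral.integral_eq_sub_of_hasDerivAt
    (fun y _ => hasDerivAt_mul_abs_self y)
    ((continuous_abs.const_mul 2).intervalIntegrable p q)
  rw [intervalIntegral.integral_const_mul] at hint
  linarith

theorem integral_abs_mul_deriv {r : ℝ → ℝ} {K : ℝ≥0} (hr : LipschitzWith K r) (p q : ℝ) :
    ∫ s in p..q, |r s| * deriv r s = ∫ y in r p..r q, |y| := by
  have habs : LipschitzWith K fun s => |r s| :=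
    one_mul K ▸ (lipschitzWith_one_norm (E := ℝ)).comp hr
  have hac := (hr.lipschitzOnWith (s := uIcc p q)).absolutelyContinuousOnInterval.fun_mul
    (habs.lipschitzOnWith (s := uIcc p q)).absolutelyContinuousOnInterval
  have hderiv : ∀ᵐ s, s ∈ uIoc p q →
      deriv (fun s => r s * |r s|) s = 2 * (|r s| * deriv r s) := by
    filter_upwards [hr.ae_differentiableAt_real] with s hs _
    rw [← mul_assoc]
    exact ((hasDerivAt_mul_abs_self (r s)).comp s hs.hasDerivAt).deriv
  have hint := hac.integral_deriv_eq_sub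
  rw [intervalIntegral.integral_congr_ae hderiv, intervalIntegral.integral_const_mul] at hint
  rw [integral_abs_eq]
  linarith

theorem sq_sub_le_four_mul_integral_abs {p q : ℝ} (h : p ≤ q) :
    (q - p) ^ 2 ≤ 4 * ∫ y in p..q, |y| := by
  rw [integral_abs_eq]
  rcases abs_cases p with ⟨hp, _⟩ | ⟨hp, _⟩ <;> rcases abs_cases q with ⟨hq, _⟩ | ⟨hq, _⟩ <;>
    rw [hp, hq] <;> nlinarith [sq_nonneg (p + q)]

theorem integral_abs_le_half_sq_sub_add {p q η : ℝ} (hη : 0 ≤ η) (h : p ≤ q) (hp : p ≤ η)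
    (hq : -η ≤ q) : ∫ y in p..q, |y| ≤ (q - p) ^ 2 / 2 + η * (q - p) := by
  rw [integral_abs_eq]
  rcases abs_cases p with ⟨hp', _⟩ | ⟨hp', _⟩ <;> rcases abs_cases q with ⟨hq', _⟩ | ⟨hq', _⟩ <;>
    rw [hp', hq'] <;> nlinarith

theorem mul_le_mul_sq_add_sq_div (x y : ℝ) {ε : ℝ} (hε : 0 < ε) :
    x * y ≤ ε * y ^ 2 + x ^ 2 / (4 * ε) := by
  have hsq : ε * y ^ 2 + x ^ 2 / (4 * ε) - x * y = (2 * ε * y - x) ^ 2 / (4 * ε) := by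
    field_simp
    ring
  have hnonneg : 0 ≤ (2 * ε * y - x) ^ 2 / (4 * ε) := by positivity
  linarith

end SignedSquare

section ChordSweep

variable {C : Set Plane} {δ M θ lam ε t₁ t₂ : ℝ}

theorem periodic_capDensity_left {X : ℝ → Plane} {L : ℝ} (hX : Function.Periodic X L) (h : ℝ → ℝ)
    (lam θ : ℝ) : Function.Periodic (fun s => capDensity X h lam s θ) L := by
  intro s
  have hderiv : deriv X (s + L) = deriv X s := by
    rw [← deriv_comp_add_const]
    exact congrArg (deriv · s) (funext hX)
  have hheight : height X h (s + L) = height X h s := by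
    simp only [funext_iff, height, hX s, implies_true]
  have hdensity : density X h (s + L) = density X h s := by
    simp only [funext_iff, density, hX s, hderiv, implies_true]
  simp only [capDensity, hheight, hdensity]

theorem IsCap.Ioc_inter_height_lt_ae_eq (hcap : IsCap C θ lam t₁ t₂) (hC : HasRadii C δ M) :
    (Ioc (arcLength (polarCurve C) θ) (arcLength (polarCurve C) θ + perimeter C) ∩
        {s | height (arcParam C) (support C) s θ < lam} : Set ℝ) =ᵐ[volume]
      Ioc (arcLength (polarCurve C) t₁) (arcLength (polarCurve C) t₂) := by
  obtain ⟨K, hK⟩ := hC.lipschitz_polarCurve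
  have hmono := monotone_arcLength hK
  have hmem : ∀ t ∈ Icc θ (θ + 2 * π),
      height (arcParam C) (support C) (arcLength (polarCurve C) t) θ < lam ↔ t ∈ Ioo t₁ t₂ := by
    intro t ht
    rw [height, hC.arcParam_arcLength, sub_lt_iff_lt_add', hcap.radial_lt_iff t ht]
  rw [← hC.arcLength_add_two_pi, eventuallyEq_set]
  filter_upwards [compl_mem_ae_iff.mpr (measure_singleton (arcLength (polarCurve C) t₁)),
    compl_mem_ae_iff.mpr (measure_singleton (arcLength (polarCurve C) t₂))] with s hne₁ hne₂
  constructor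
  · rintro ⟨hs, hheight⟩
    obtain ⟨t, ht, rfl⟩ := intermediate_value_Icc (by linarith [Real.pi_pos])
      (continuous_arcLength hK).continuousOn (Ioc_subset_Icc_self hs)
    have htIoo := (hmem t ht).mp hheight
    exact ⟨(hmono htIoo.1.le).lt_of_ne' hne₁, hmono htIoo.2.le⟩
  · intro hs
    obtain ⟨t, rfl⟩ := hC.surjective_arcLength_polarCurve s
    have ht₁ : t₁ < t := hmono.reflect_lt hs.1
    have ht₂ : t < t₂ := hmono.reflect_lt (hs.2.lt_of_ne hne₂)
    have htIcc : t ∈ Icc θ (θ + 2 * π) := ⟨hcap.le_left.trans ht₁.le, ht₂.le.trans hcap.right_le⟩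
    exact ⟨⟨(hmono hcap.le_left).trans_lt hs.1, hmono htIcc.2⟩, (hmem t htIcc).mpr ⟨ht₁, ht₂⟩⟩

namespace HasRadii

theorem integral_density_eq (hC : HasRadii C δ M) (θ s₁ s₂ : ℝ) :
    ∫ s in s₁..s₂, density (arcParam C) (support C) s θ
      = ∫ y in tangential (arcParam C s₂) θ - deriv (support C) θ..
          tangential (arcParam C s₁) θ - deriv (support C) θ, |y| := by
  have hlip : LipschitzWith 1 fun s => tangential (arcParam C s) θ - deriv (support C) θ := by
    refine LipschitzWith.of_dist_le_mul fun x y => ?_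
    rw [Real.dist_eq, sub_sub_sub_cancel_right, ← tangential_sub]
    refine (abs_tangential_le _ _).trans ?_
    rw [← dist_eq_norm]
    exact hC.lipschitz_arcParam.dist_le_mul x y
  rw [← integral_abs_mul_deriv hlip, intervalIntegral.integral_symm,
    ← intervalIntegral.integral_neg]
  refine intervalIntegral.integral_congr_ae ?_
  filter_upwards [hC.lipschitz_arcParam.ae_differentiableAt_real] with s hs _
  rw [((hasDerivAt_tangential_comp θ hs.hasDerivAt).sub_const _).deriv, density, mul_neg, neg_neg]

theorem sweep_eq_integral_abs (hC : HasRadii C δ M) (hcap : IsCap C θ lam t₁ t₂) :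
    sweep (arcParam C) (support C) (perimeter C) lam θ
      = ∫ y in tangential (polarCurve C t₂) θ - deriv (support C) θ..
          tangential (polarCurve C t₁) θ - deriv (support C) θ, |y| := by
  obtain ⟨K, hK⟩ := hC.lipschitz_polarCurve
  set V := arcLength (polarCurve C)
  have hmeas : MeasurableSet {s | height (arcParam C) (support C) s θ < lam} :=
    (isOpen_lt (hC.isSupportedCurve.continuous_height.comp (.prodMk_left θ))
      continuous_const).measurableSet
  calc sweep (arcParam C) (support C) (perimeter C) lam θ
      = ∫ s in (0 : ℝ)..0 + perimeter C, capDensity (arcParam C) (support C) lam s θ := by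
        rw [zero_add, intervalIntegral.integral_of_le hC.perimeter_pos.le,
          ← integral_Ico_eq_integral_Ioc, sweep]
    _ = ∫ s in V θ..V θ + perimeter C, capDensity (arcParam C) (support C) lam s θ :=
        (periodic_capDensity_left hC.periodic_arcParam _ lam θ).intervalIntegral_add_eq _ _
    _ = ∫ s in Ioc (V θ) (V θ + perimeter C) ∩ {s | height (arcParam C) (support C) s θ < lam},
          density (arcParam C) (support C) s θ := by
        rw [intervalIntegral.integral_of_le (by linarith [hC.perimeter_pos]),
          ← setIntegral_indicator hmeas]
        rfl
    _ = ∫ s in V t₁..V t₂, density (arcParam C) (support C) s θ := by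
        rw [intervalIntegral.integral_of_le (monotone_arcLength hK hcap.left_le_right),
          setIntegral_congr_set (hcap.Ioc_inter_height_lt_ae_eq hC)]
    _ = _ := by
        rw [hC.integral_density_eq, hC.arcParam_arcLength, hC.arcParam_arcLength]

theorem chordLength_sq_le (hC : HasRadii C δ M) (θ : ℝ) (hlam : 0 < lam) (hlt : lam < δ) :
    chordLength C θ lam ^ 2 ≤ 4 * sweep (arcParam C) (support C) (perimeter C) lam θ := by
  obtain ⟨t₁, t₂, hcap⟩ := hC.exists_isCap θ hlam hlt
  have hsq := sq_sub_le_four_mul_integral_abs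
    (sub_le_sub_right hcap.tangential_le (deriv (support C) θ))
  rwa [sub_sub_sub_cancel_right, ← hcap.chordLength_eq, ← hC.sweep_eq_integral_abs hcap] at hsq

theorem closure_subset_closedBall (hC : HasRadii C δ M) :
    closure C ⊆ Metric.closedBall (center C) M :=
  closure_minimal (fun y hy => mem_closedBall_iff_norm.mpr (hC.norm_le y hy))
    Metric.isClosed_closedBall

theorem exists_radial_eq_support (hC : HasRadii C δ M) (θ : ℝ) :
    ∃ x ∈ closure C, radial x θ = support C θ := by
  have hcompact : IsCompact (closure C) := Metric.isCompact_of_isClosed_isBounded isClosed_closure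
    (Metric.isBounded_closedBall.subset hC.closure_subset_closedBall)
  obtain ⟨x, hx, hmin⟩ := hcompact.exists_isMinOn ⟨_, subset_closure hC.center_mem⟩
    (continuous_radial_left θ).continuousOn
  exact ⟨x, hx, le_antisymm (hC.le_support fun y hy => hmin (subset_closure hy))
    (hC.support_le_of_mem_closure hx θ)⟩

theorem tangential_eq_deriv_support (hC : HasRadii C δ M) {x : Plane} (hx : x ∈ closure C)
    (hxr : radial x θ = support C θ) (hd : DifferentiableAt ℝ (support C) θ) :
    tangential x θ = deriv (support C) θ := by
  have hmin : IsLocalMin (fun φ => radial x φ - support C φ) θ := by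
    refine Eventually.of_forall fun φ => ?_
    simp only [hxr, sub_self]
    exact sub_nonneg.mpr (hC.support_le_of_mem_closure hx φ)
  exact sub_eq_zero.mp (hmin.hasDerivAt_eq_zero ((hasDerivAt_radial x θ).sub hd.hasDerivAt))

theorem exists_mem_closure_abs_tangential_sub_le (hC : HasRadii C δ M)
    (hd : DifferentiableAt ℝ (support C) θ) (hlam : 0 < lam) (hlt : lam < δ) :
    ∃ x ∈ closure C, radial x θ = support C θ + lam ∧
      |tangential x θ - deriv (support C) θ| ≤ M / δ * lam := by
  obtain ⟨p, hp, hpr⟩ := hC.exists_radial_eq_support θ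
  have hδ := hC.pos
  have hdepth : δ ≤ radial (center C - p) θ := by
    rw [radial_sub, hpr]
    linarith [hC.support_add_le θ]
  have hdepth_pos := hδ.trans_le hdepth
  set μ := lam / radial (center C - p) θ with hμ
  have hμ_pos : 0 < μ := div_pos hlam hdepth_pos
  have hμ_le : μ ≤ 1 := (div_le_one hdepth_pos).mpr (hlt.le.trans hdepth)
  refine ⟨p + μ • (center C - p), hC.convex.closure.add_smul_sub_mem hp
    (subset_closure hC.center_mem) ⟨hμ_pos.le, hμ_le⟩, ?_, ?_⟩
  · rw [radial_add, radial_smul, hpr, hμ, div_mul_cancel₀ _ hdepth_pos.ne']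
  · have hnorm : |tangential (center C - p) θ| ≤ M :=
      (abs_tangential_le _ _).trans (mem_closedBall_iff_norm'.mp (hC.closure_subset_closedBall hp))
    rw [tangential_add, hC.tangential_eq_deriv_support hp hpr hd, add_sub_cancel_left,
      tangential_smul, abs_mul, abs_of_pos hμ_pos]
    calc μ * |tangential (center C - p) θ| ≤ lam / δ * M := by
          rw [hμ]
          gcongr
      _ = M / δ * lam := by ring

theorem sweep_le (hC : HasRadii C δ M) (hd : DifferentiableAt ℝ (support C) θ) (hlam : 0 < lam)
    (hlt : lam < δ) (hε : 0 < ε) :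
    sweep (arcParam C) (support C) (perimeter C) lam θ
      ≤ (1 / 2 + ε) * chordLength C θ lam ^ 2 + (M / δ * lam) ^ 2 / (4 * ε) := by
  obtain ⟨t₁, t₂, hcap⟩ := hC.exists_isCap θ hlam hlt
  obtain ⟨x, hx, hxr, hxt⟩ := hC.exists_mem_closure_abs_tangential_sub_le hd hlam hlt
  obtain ⟨hlow, hhigh⟩ := abs_le.mp hxt
  have hmem := hcap.tangential_mem x hx hxr
  have hsweep := integral_abs_le_half_sq_sub_add ((abs_nonneg _).trans hxt)
    (sub_le_sub_right hcap.tangential_le (deriv (support C) θ))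
    (by linarith [hmem.1]) (by linarith [hmem.2])
  rw [← hC.sweep_eq_integral_abs hcap, sub_sub_sub_cancel_right, ← hcap.chordLength_eq] at hsweep
  linarith [mul_le_mul_sq_add_sq_div (M / δ * lam) (chordLength C θ lam) hε]

end HasRadii

end ChordSweep

section Perimeter

variable {C : Set Plane} {δ M a b lam ε : ℝ}

theorem opposite_arc (a b : ℝ) : opposite (arc a b) = arc (a + π) (b + π) := by
  rw [opposite, arc, arc, image_image, ← image_add_const_Icc, image_image]
  simp only [Real.Angle.coe_add]

theorem lintegral_Icc_add_right (f : ℝ → ℝ≥0∞) (a b c : ℝ) :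
    ∫⁻ t in Icc a b, f (t + c) = ∫⁻ t in Icc (a + c) (b + c), f t := by
  rw [← (measurePreserving_add_right volume c).setLIntegral_comp_preimage_emb
    (measurableEmbedding_addRight c) f (Icc (a + c) (b + c)), preimage_add_const_Icc,
    add_sub_cancel_right, add_sub_cancel_right]

theorem liminf_le_mul_liminf {ι : Type*} {l : Filter ι} [l.NeBot] {r : ℝ≥0∞}
    {f g factor error : ι → ℝ≥0∞} (hr₀ : r ≠ 0) (hr : r ≠ ∞) (hfactor : Tendsto factor l (𝓝 r))
    (herror : Tendsto error l (𝓝 0)) (hle : ∀ᶠ i in l, f i ≤ factor i * g i + error i) :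
    liminf f l ≤ r * liminf g l := by
  calc liminf f l
      ≤ liminf (factor * g + error) l := liminf_le_liminf hle
    _ = liminf (factor * g) l := ENNReal.liminf_add_of_right_tendsto_zero herror _
    _ ≤ limsup factor l * liminf g l := by
        refine ENNReal.liminf_mul_le (Or.inl ?_) (Or.inl ?_) <;> rwa [hfactor.limsup_eq]
    _ = r * liminf g l := by rw [hfactor.limsup_eq]

namespace HasRadii

theorem portion_arc (hC : HasRadii C δ M) (a b : ℝ) :
    portion C (arc a b)
      = volume.restrict (Ico 0 (perimeter C)) (touchSet (arcParam C) (support C) a b) := by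
  rw [Measure.restrict_apply (hC.isSupportedCurve.isClosed_touchSet a b).measurableSet, portion]
  congr 1
  ext s
  have mem_normals_iff (θ : ℝ) :
      (θ : Real.Angle) ∈ normals C s ↔ height (arcParam C) (support C) s θ = 0 := by
    rw [normals, mem_ofPred_eq, inner_u, height, sub_eq_zero, support, eq_comm]
  rw [mem_ofPred_eq, mem_inter_iff, and_comm]
  refine and_congr_left fun _ => ?_
  constructor
  · rintro ⟨_, hnormal, θ, hθ, rfl⟩
    exact ⟨θ, hθ, (mem_normals_iff θ).mp hnormal⟩
  · rintro ⟨θ, hθ, htouch⟩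
    exact ⟨θ, (mem_normals_iff θ).mpr htouch, θ, hθ, rfl⟩

theorem ofReal_integral_sweep_le (hC : HasRadii C δ M) (a b : ℝ) (hlam : 0 < lam) (hlt : lam < δ)
    (hε : 0 < ε) :
    ENNReal.ofReal (∫ θ in Icc a b, sweep (arcParam C) (support C) (perimeter C) lam θ)
      ≤ ENNReal.ofReal (1 / 2 + ε) * (∫⁻ θ in Icc a b, ENNReal.ofReal (chordLength C θ lam ^ 2))
        + ENNReal.ofReal ((M / δ * lam) ^ 2 / (4 * ε)) * ENNReal.ofReal (b - a) := by
  obtain ⟨K, hK⟩ := hC.lipschitz_support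
  calc ENNReal.ofReal (∫ θ in Icc a b, sweep (arcParam C) (support C) (perimeter C) lam θ)
      ≤ ∫⁻ θ in Icc a b, ENNReal.ofReal (sweep (arcParam C) (support C) (perimeter C) lam θ) :=
        ofReal_integral_le_lintegral_ofReal _ _
    _ ≤ ∫⁻ θ in Icc a b, (ENNReal.ofReal (1 / 2 + ε) * ENNReal.ofReal (chordLength C θ lam ^ 2)
          + ENNReal.ofReal ((M / δ * lam) ^ 2 / (4 * ε))) := by
        refine lintegral_mono_ae (ae_restrict_of_ae ?_)
        filter_upwards [hK.ae_differentiableAt_real] with θ hd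
        rw [← ENNReal.ofReal_mul (by positivity), ← ENNReal.ofReal_add (by positivity)
          (by positivity)]
        exact ENNReal.ofReal_le_ofReal (hC.sweep_le hd hlam hlt hε)
    _ = ENNReal.ofReal (1 / 2 + ε) * (∫⁻ θ in Icc a b, ENNReal.ofReal (chordLength C θ lam ^ 2))
        + ENNReal.ofReal ((M / δ * lam) ^ 2 / (4 * ε)) * ENNReal.ofReal (b - a) := by
        rw [lintegral_add_right _ measurable_const,
          lintegral_const_mul' _ _ ENNReal.ofReal_ne_top, setLIntegral_const, Real.volume_Icc]

-- `ε = √lam` balances the loss in the leading coefficient against the error term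
theorem ofReal_inv_mul_integral_sweep_le (hC : HasRadii C δ M) (a b : ℝ) (hlam : 0 < lam)
    (hlt : lam < δ) :
    ENNReal.ofReal (lam⁻¹ * ∫ θ in Icc a b, sweep (arcParam C) (support C) (perimeter C) lam θ)
      ≤ ENNReal.ofReal (1 / 2 + √lam) * (ENNReal.ofReal lam⁻¹ *
            ∫⁻ θ in Icc a b, ENNReal.ofReal (chordLength C θ lam ^ 2))
        + ENNReal.ofReal ((M / δ) ^ 2 / 4 * √lam) * ENNReal.ofReal (b - a) := by
  have inv_nonneg := (inv_pos.mpr hlam).le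
  have error_eq : lam⁻¹ * ((M / δ * lam) ^ 2 / (4 * √lam)) = (M / δ) ^ 2 / 4 * √lam := by
    field_simp
    rw [Real.sq_sqrt hlam.le]
    ring
  rw [ENNReal.ofReal_mul inv_nonneg]
  refine (mul_le_mul_right (hC.ofReal_integral_sweep_le a b hlam hlt (Real.sqrt_pos.mpr hlam))
    _).trans_eq ?_
  rw [mul_add, mul_left_comm, ← mul_assoc (ENNReal.ofReal lam⁻¹) (ENNReal.ofReal _),
    ← ENNReal.ofReal_mul inv_nonneg, error_eq]

theorem two_mul_portion_le_liminf (hC : HasRadii C δ M) (hab : a < b) (hb : b ≤ a + 2 * π) :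
    2 * portion C (arc a b) ≤ liminf (fun lam => ENNReal.ofReal lam⁻¹ *
      ∫⁻ θ in Icc a b, ENNReal.ofReal (chordLength C θ lam ^ 2)) (𝓝[>] 0) := by
  have sqrt_limit : Tendsto Real.sqrt (𝓝[>] 0) (𝓝 0) :=
    (Real.continuous_sqrt.tendsto' 0 0 Real.sqrt_zero).mono_left nhdsWithin_le_nhds
  have factor_limit : Tendsto (fun lam => ENNReal.ofReal (1 / 2 + √lam)) (𝓝[>] 0) (𝓝 2⁻¹) := by
    have limit := ENNReal.tendsto_ofReal (sqrt_limit.const_add (1 / 2))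
    rwa [add_zero, one_div, ENNReal.ofReal_inv_of_pos two_pos, ENNReal.ofReal_ofNat,
      ← one_div] at limit
  have error_limit : Tendsto (fun lam => ENNReal.ofReal ((M / δ) ^ 2 / 4 * √lam) *
      ENNReal.ofReal (b - a)) (𝓝[>] 0) (𝓝 0) := by
    have limit := ENNReal.tendsto_ofReal (sqrt_limit.const_mul ((M / δ) ^ 2 / 4))
    rw [mul_zero, ENNReal.ofReal_zero] at limit
    simpa only [zero_mul] using ENNReal.Tendsto.mul_const limit (Or.inr ENNReal.ofReal_ne_top)
  rw [ENNReal.mul_le_iff_le_inv two_ne_zero ENNReal.ofNat_ne_top, hC.portion_arc]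
  refine (hC.isSupportedCurve.measure_touchSet_le_liminf hab hb _).trans
    (liminf_le_mul_liminf (by simp) (by simp) factor_limit error_limit ?_)
  filter_upwards [Ioo_mem_nhdsGT hC.pos] with lam hlam
  exact hC.ofReal_inv_mul_integral_sweep_le a b hlam.1 hlam.2

theorem portion_add_portion_opposite_le_liminf (hC : HasRadii C δ M) (hab : a < b)
    (hb : b ≤ a + 2 * π) :
    portion C (arc a b) + portion C (opposite (arc a b))
      ≤ liminf (fun lam => ENNReal.ofReal lam⁻¹ *
          ∫⁻ θ in Icc a b, ENNReal.ofReal (gam C θ lam ^ 2)) (𝓝[>] 0) := by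
  set G : ℝ → ℝ≥0∞ := fun lam => ENNReal.ofReal lam⁻¹ *
    ∫⁻ θ in Icc a b, ENNReal.ofReal (gam C θ lam ^ 2)
  have le_self : 2 * portion C (arc a b) ≤ liminf G (𝓝[>] 0) := by
    refine (hC.two_mul_portion_le_liminf hab hb).trans
      (liminf_le_liminf (Eventually.of_forall fun lam => ?_))
    dsimp only [G]
    gcongr with θ
    · exact Metric.diam_nonneg
    · exact le_max_left _ _
  have le_opposite : 2 * portion C (opposite (arc a b)) ≤ liminf G (𝓝[>] 0) := by
    rw [opposite_arc]
    refine (hC.two_mul_portion_le_liminf (by linarith) (by linarith)).trans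
      (liminf_le_liminf (Eventually.of_forall fun lam => ?_))
    dsimp only [G]
    rw [← lintegral_Icc_add_right fun θ => ENNReal.ofReal (chordLength C θ lam ^ 2)]
    gcongr with θ
    · exact Metric.diam_nonneg
    · rw [Real.Angle.coe_add]
      exact le_max_right _ _
  rw [← ENNReal.mul_le_mul_iff_right two_ne_zero ENNReal.ofNat_ne_top, mul_add,
    two_mul (liminf G _)]
  exact add_le_add le_self le_opposite

theorem sweep_nonneg (hC : HasRadii C δ M) (hlam : 0 < lam) (hlt : lam < δ) (θ : ℝ) :
    0 ≤ sweep (arcParam C) (support C) (perimeter C) lam θ := by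
  linarith [hC.chordLength_sq_le θ hlam hlt, sq_nonneg (chordLength C θ lam)]

theorem lintegral_sweep_le (hC : HasRadii C δ M) (hb : b ≤ a + 2 * π) (hlam : 0 < lam)
    (hlt : lam < δ) :
    ENNReal.ofReal lam⁻¹ *
        ∫⁻ θ in Icc a b, ENNReal.ofReal (sweep (arcParam C) (support C) (perimeter C) lam θ)
      ≤ 2 * volume.restrict (Ico 0 (perimeter C)) (lowSet (arcParam C) (support C) a b lam) := by
  rw [← ofReal_integral_eq_lintegral_ofReal (hC.isSupportedCurve.integrableOn_sweep a b _ lam)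
    (Eventually.of_forall (hC.sweep_nonneg hlam hlt)), ← ENNReal.ofReal_mul (inv_pos.mpr hlam).le]
  exact hC.isSupportedCurve.ofReal_integral_sweep_le_measure_lowSet hb _ hlam

theorem gam_sq_le (hC : HasRadii C δ M) (hlam : 0 < lam) (hlt : lam < δ) (θ : ℝ) :
    gam C θ lam ^ 2 ≤ 4 * sweep (arcParam C) (support C) (perimeter C) lam θ
      + 4 * sweep (arcParam C) (support C) (perimeter C) lam (θ + π) := by
  have self := hC.chordLength_sq_le θ hlam hlt
  have opp := hC.chordLength_sq_le (θ + π) hlam hlt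
  rw [Real.Angle.coe_add] at opp
  rw [gam]
  rcases max_choice (chordLength C θ lam) (chordLength C (θ + π) lam) with hmax | hmax <;>
    rw [hmax] <;> linarith [hC.sweep_nonneg hlam hlt θ, hC.sweep_nonneg hlam hlt (θ + π)]

theorem lintegral_gam_sq_le (hC : HasRadii C δ M) (a b : ℝ) (hlam : 0 < lam) (hlt : lam < δ) :
    ∫⁻ θ in Icc a b, ENNReal.ofReal (gam C θ lam ^ 2)
      ≤ 4 * (∫⁻ θ in Icc a b,
            ENNReal.ofReal (sweep (arcParam C) (support C) (perimeter C) lam θ))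
        + 4 * ∫⁻ θ in Icc (a + π) (b + π),
            ENNReal.ofReal (sweep (arcParam C) (support C) (perimeter C) lam θ) := by
  set S := sweep (arcParam C) (support C) (perimeter C) lam
  have hS : AEMeasurable (fun θ => 4 * ENNReal.ofReal (S θ)) (volume.restrict (Icc a b)) :=
    (hC.isSupportedCurve.integrableOn_sweep a b _ lam).aemeasurable.ennreal_ofReal.const_mul _
  have four : (4 : ℝ≥0∞) = ENNReal.ofReal 4 := (ENNReal.ofReal_ofNat 4).symm
  rw [← lintegral_Icc_add_right fun θ => ENNReal.ofReal (S θ),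
    ← lintegral_const_mul' _ _ ENNReal.ofNat_ne_top,
    ← lintegral_const_mul' _ _ ENNReal.ofNat_ne_top, ← lintegral_add_left' hS]
  refine lintegral_mono fun θ => ?_
  have hnonneg := hC.sweep_nonneg hlam hlt
  rw [four, ← ENNReal.ofReal_mul zero_le_four, ← ENNReal.ofReal_mul zero_le_four,
    ← ENNReal.ofReal_add (mul_nonneg zero_le_four (hnonneg _))
      (mul_nonneg zero_le_four (hnonneg _))]
  exact ENNReal.ofReal_le_ofReal (hC.gam_sq_le hlam hlt θ)

theorem limsup_le_portion_add_portion_opposite (hC : HasRadii C δ M) (hb : b ≤ a + 2 * π) :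
    limsup (fun lam => ENNReal.ofReal lam⁻¹ *
        ∫⁻ θ in Icc a b, ENNReal.ofReal (gam C θ lam ^ 2)) (𝓝[>] 0)
      ≤ 8 * portion C (arc a b) + 8 * portion C (opposite (arc a b)) := by
  have limit (a b : ℝ) := ENNReal.Tendsto.const_mul (a := 8)
    (hC.isSupportedCurve.tendsto_measure_lowSet a b (perimeter C))
    (Or.inr ENNReal.ofNat_ne_top)
  rw [opposite_arc, hC.portion_arc, hC.portion_arc,
    ← ((limit a b).add (limit (a + π) (b + π))).limsup_eq]
  refine limsup_le_limsup ?_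
  filter_upwards [Ioo_mem_nhdsGT hC.pos] with lam ⟨hlam, hlt⟩
  have self := mul_le_mul_right (hC.lintegral_sweep_le hb hlam hlt) 4
  have opp := mul_le_mul_right (hC.lintegral_sweep_le (a := a + π) (b := b + π) (by linarith)
    hlam hlt) 4
  rw [← mul_assoc 4 2] at self opp
  refine (mul_le_mul_right (hC.lintegral_gam_sq_le a b hlam hlt) _).trans ?_
  rw [mul_add, mul_left_comm, mul_left_comm (ENNReal.ofReal lam⁻¹)]
  norm_num at self opp ⊢
  exact add_le_add self opp

end HasRadii

end Perimeter

end PlanarBody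

end

theorem corollaryc2 (C : Set PlanarBody.Plane) (hC : PlanarBody.IsConvexBody C)
    (a b : ℝ) (hab : a < b) (hba : b ≤ a + 2 * Real.pi) :
    PlanarBody.portion C (PlanarBody.arc a b)
          + PlanarBody.portion C (PlanarBody.opposite (PlanarBody.arc a b))
        ≤ Filter.liminf (fun ρ : ℝ => ENNReal.ofReal ρ *
            ∫⁻ t in Set.Icc a b, ENNReal.ofReal (PlanarBody.gam C (t : Real.Angle) ρ⁻¹ ^ 2))
            Filter.atTop ∧
    Filter.limsup (fun ρ : ℝ => ENNReal.ofReal ρ *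
            ∫⁻ t in Set.Icc a b, ENNReal.ofReal (PlanarBody.gam C (t : Real.Angle) ρ⁻¹ ^ 2))
            Filter.atTop
        ≤ 8 * PlanarBody.portion C (PlanarBody.arc a b)
          + 8 * PlanarBody.portion C (PlanarBody.opposite (PlanarBody.arc a b)) := by
  obtain ⟨δ, M, radii⟩ := hC.exists_hasRadii
  have lower := (radii.portion_add_portion_opposite_le_liminf hab hba).trans
    tendsto_inv_atTop_nhdsGT_zero.liminf_le_liminf_comp
  have upper := tendsto_inv_atTop_nhdsGT_zero.limsup_comp_le_limsup.trans
    (radii.limsup_le_portion_add_portion_opposite hba)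
  simp only [Function.comp_def, inv_inv] at lower upper
  exact ⟨lower, upper⟩
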